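/- Let $0\le q<1$ and $\delta'>0$, and let $J=J_n\ge 2$, $T=T_n\ge 1$ be integers with $\log J/T\to 0$. For each $n$ let $X_1,\dots,X_T$ be random vectors in $\mathbb R^J$ with finite fourth moments, $\mathsf E X_t=0$ and $\mathsf E X_tX_t^\top=\Sigma=[\sigma_{ij}]$ for all $t$. Let $\hat\Sigma=T^{-1}\sum_{t=1}^T(X_t-\bar X)(X_t-\bar X)^\top$ with $\bar X=T^{-1}\sum_{t=1}^T X_t$, and for a matrix $A=[a_{ij}]$ let $T_s(A)=[a_{ij}\mathbf 1(|a_{ij}|\ge s)]$ be its hard thresholding at level $s$. Let $\mathcal U(q,c_0(J),M)$ be the class of covariance matrices $\Sigma$ with $\sigma_{ii}\le M$ and $\sum_{j=1}^J|\sigma_{ij}|^q\le c_0(J)$ for all $i$ (where $0^0=0$). For $\sigma$-algebras $\mathcal A,\mathcal B$ put $\beta(\mathcal A,\mathcal B)=\mathsf E\,\mathrm{ess\,sup}\{|\mathsf P(B\mid\mathcal A)-\mathsf P(B)|:B\in\mathcal B\}$, and for a sequence $Y_1,\dots,Y_T$ let $\beta_Y(k)=\sup_m\beta(\sigma(Y_t:t\le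 m),\sigma(Y_t:t\ge m+k))$. Assume that, for constants $\sigma^2$, $M$, $C$, a sequence $\rho_n\to0$ and lags $k_n\ge1$ with $k_n\le\sqrt{T/\log J}$ for all large $n$ (for example $k_n=1$), one has for all $i,j$: (A1) the centred products $V_t^{ij}=X_{ti}X_{tj}-\sigma_{ij}$ have mean zero for every $t$; (A2) $m^{-1}\,\mathsf E\big(V_a^{ij}+\dots+V_{a+m}^{ij}\big)^2\le\sigma^2$ for all $a\ge1$, $m\ge1$ with $a+m\le T$; (A3) $|X_{ti}X_{tj}|\le M$ for all $t,i,j$ simultaneously, with probability at least $1-\rho_n$; (A4) the $\beta$-mixing coefficients at lag $k_n$ of the product sequence $\{X_{ti}X_{tj}\}_{t=1}^T$ and of the coordinate sequence $\{X_{ti}\}_{t=1}^T$ are at most $C\,\big(J^{2+\delta'}\sqrt{T\log J}\big)^{-1}$. Then there is $M_0$, depending only on $\sigma^2$ and $M$, such that for every $M'\ge M_0$ and $s_T=M'\sqrt{\log J/T}$, $$\|T_{s_T}(\hat\Sigma)-\Sigma\|=O_P\Big\{c_0(J)\Big(\frac{\log J}{T}\Big)^{(1-q)/2}\Big\},\qquad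 J^{-1}\|T_{s_T}(\hat\Sigma)-\Sigma\|_F^2=O_P\Big\{c_0(J)\Big(\frac{\log J}{T}\Big)^{1-q/2}\Big\},$$ with $\|\cdot\|$ the operator norm and $\|\cdot\|_F$ the Frobenius norm, uniformly over all such processes with $\Sigma\in\mathcal U(q,c_0(J),M)$: for every $\varepsilon>0$ there is $K>0$ such that for all large $n$ and every such process, each of the two errors exceeds $K$ times its rate with probability at most $\varepsilon$. -/

import Mathlib

open MeasureTheory Filter Topology

noncomputable section

namespace ThresholdCov

/-- The `β`-mixing (absolute regularity) coefficient
`β(𝒰, 𝒱) = E ess sup {|P(V | 𝒰) - P(V)| : V ∈ 𝒱}` of two sub-σ-algebras.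
The essential supremum of a family of functions is its least measurable almost sure upper bound,
so its expectation is the least expectation of a measurable almost sure upper bound `g`. -/
def betaCoef {Ω : Type*} [mΩ : MeasurableSpace Ω] (P : Measure Ω)
    (mU mV : MeasurableSpace Ω) : ENNReal :=
  ⨅ (g : Ω → ENNReal) (_ : Measurable[mΩ] g)
    (_ : ∀ V : Set Ω, MeasurableSet[mV] V →
      ∀ᵐ ω ∂P, ENNReal.ofReal |(P[V.indicator (fun _ => (1 : ℝ)) | mU]) ω - P.real V| ≤ g ω),
    ∫⁻ ω, g ω ∂P

/-- The σ-algebra generated by the variables `Y t` whose time index satisfies `p`. -/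
@[reducible] def sigmaOf {Ω : Type*} {T : ℕ} (Y : Fin T → Ω → ℝ) (p : ℕ → Prop) : MeasurableSpace Ω :=
  ⨆ (t : Fin T) (_ : p t), MeasurableSpace.comap (Y t) inferInstance

/-- The `β`-mixing coefficient at lag `k` of a finite sequence: the supremum over the cut `m` of the
coefficient between `σ(Y t : t ≤ m)` and `σ(Y t : t ≥ m + k)`. -/
def betaMix {Ω : Type*} [MeasurableSpace Ω] (P : Measure Ω) {T : ℕ} (Y : Fin T → Ω → ℝ)
    (k : ℕ) : ENNReal :=
  ⨆ m : ℕ, betaCoef P (sigmaOf Y fun t => t ≤ m) (sigmaOf Y fun t => m + k ≤ t)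

/-- The sample mean of the coordinate `i`. -/
def sampleMean {J T : ℕ} (x : Fin T → Fin J → ℝ) (i : Fin J) : ℝ :=
  (T : ℝ)⁻¹ * ∑ t, x t i

/-- The sample covariance matrix `T⁻¹ ∑ₜ (xₜ - x̄)(xₜ - x̄)ᵀ`. -/
def sampleCov {J T : ℕ} (x : Fin T → Fin J → ℝ) : Matrix (Fin J) (Fin J) ℝ :=
  Matrix.of fun i j =>
    (T : ℝ)⁻¹ * ∑ t, (x t i - sampleMean x i) * (x t j - sampleMean x j)

open Classical in
/-- Hard thresholding of a matrix at level `s`. -/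
def threshold {J : ℕ} (s : ℝ) (A : Matrix (Fin J) (Fin J) ℝ) : Matrix (Fin J) (Fin J) ℝ :=
  Matrix.of fun i j => if s ≤ |A i j| then A i j else 0

/-- The operator norm with respect to the Euclidean norm. -/
def opNorm {J : ℕ} (A : Matrix (Fin J) (Fin J) ℝ) : ℝ :=
  ‖Matrix.toEuclideanCLM (n := Fin J) (𝕜 := ℝ) A‖

/-- The squared Frobenius norm. -/
def frobSq {J : ℕ} (A : Matrix (Fin J) (Fin J) ℝ) : ℝ :=
  ∑ i, ∑ j, A i j ^ 2

open Classical in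
/-- The uniformity class of covariance matrices with `σᵢᵢ ≤ M` and `∑ⱼ |σᵢⱼ|^q ≤ c` for all `i`;
zero entries never contribute, so that for `q = 0` the sum counts the nonzero entries of a row. -/
def uniformityClass {J : ℕ} (q c M : ℝ) : Set (Matrix (Fin J) (Fin J) ℝ) :=
  {S | S.PosSemidef ∧ (∀ i, S i i ≤ M) ∧
    ∀ i, ∑ j, (if S i j = 0 then 0 else |S i j| ^ q) ≤ c}

/-- The conditions on a `J`-dimensional time series `X` of length `T` with covariance matrix `S`:
`σ` and `M` are the constants of the block variance and boundedness conditions, `ρ` bounds the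
probability that the boundedness condition fails, and `b` bounds the `β`-mixing coefficients at
lag `k`. -/
structure Admissible {Ω : Type*} [MeasurableSpace Ω] (P : Measure Ω) {J T : ℕ}
    (X : Fin T → Fin J → Ω → ℝ) (S : Matrix (Fin J) (Fin J) ℝ)
    (σ M ρ : ℝ) (k : ℕ) (b : ℝ) : Prop where
  measurable : ∀ t i, Measurable (X t i)
  memLp : ∀ t i, MemLp (X t i) 4 P
  mean_zero : ∀ t i, ∫ ω, X t i ω ∂P = 0
  /-- `E (Xₜ Xₜᵀ) = S` for every `t`: the centred products `Xₜᵢ Xₜⱼ - Sᵢⱼ` have mean zero. -/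
  cov : ∀ t i j, ∫ ω, X t i ω * X t j ω ∂P = S i j
  /-- Block variances; the block `a, …, a + m` has `m = b - a ≥ 1`. -/
  block : ∀ i j, ∀ a b : Fin T, a < b →
    ((b : ℝ) - (a : ℝ))⁻¹ *
      ∫ ω, (∑ t ∈ Finset.Icc a b, (X t i ω * X t j ω - S i j)) ^ 2 ∂P ≤ σ ^ 2
  bounded : P {ω | ∃ t i j, M < |X t i ω * X t j ω|} ≤ ENNReal.ofReal ρ
  mixing_prod : ∀ i j, betaMix P (fun t ω => X t i ω * X t j ω) k ≤ ENNReal.ofReal b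
  mixing_coord : ∀ i, betaMix P (fun t ω => X t i ω) k ≤ ENNReal.ofReal b

end ThresholdCov

end

open MeasureTheory Filter Topology

noncomputable section

namespace ThresholdCov

/-! Write `w = √(log J / T)`. The proof combines a uniform deviation bound `max |Σ̂ - Σ| ≤ lam² A
w`, valid with high probability, with a deterministic estimate for thresholding.

Deviation. Cut time into blocks of length `ℓ = lam ⌊1/w⌋`, which is at least the lag `k`. Blocks
with indices of the same parity are separated by a whole block, so each can be replaced in turn by
an independent copy of itself at the price of one `β`-coefficient
(`ofReal_integral_add_sub_le_betaCoef`, iterated in `integral_comp_sum_le_of_betaChain`). The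
Chernoff bound for independent summands then applies (`measureReal_le_sum_of_betaChain`). On the
event of (A3) the block sums are of order `ℓ`, and by (A2) block sums of centred products have
variance of order `ℓ`. A Chernoff parameter of order `1/ℓ` gives the tail `exp(-4 lam log J)`, which
survives the union over `J²` entries; the `T/ℓ` replacements cost in total a multiple of
`J^{-(2+δ')} / lam`. Sample means enter only through products of two of them, so they need accuracy
`√w` only, and a crude variance bound of order `ℓ²` is enough for them. Since boundedness holds only
on an event, the block sums are truncated, and the resulting bias is controlled by second moments.

Thresholding. If all deviations are at most half the level `s`, each entry of the error is at most
`min(|σᵢⱼ|, 3s/2)`. Hence each row sum of the error is at most `c₀ (3s/2)^{1-q}`, and the Schur test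
bounds the operator norm.

Bounded dimension. `J` need not diverge, so a power of `1/J` need not be small, whereas the
threshold constant may not depend on `ε`. For large `J` the choice `lam = 1` works. For `J ≤ J₀` a
large `lam` makes the probability small, but the deviation bound may then exceed the threshold;
`exists_error_set_of_le` separates the case where `c₀` absorbs any error of order `w` from the case
where `Σ` is so small that everything is thresholded to zero. -/

/-! ### Decoupling by `β`-coefficients and the Chernoff bound -/

theorem ofReal_integral_le_lintegral {Ω : Type*} [MeasurableSpace Ω] {P : Measure Ω} {f : Ω → ℝ}
    (hf : Integrable f P) : ENNReal.ofReal (∫ ω, f ω ∂P) ≤ ∫⁻ ω, ENNReal.ofReal (f ω) ∂P := by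
  have h : ∫⁻ ω, ENNReal.ofReal (f ω) ∂P = ∫⁻ ω, ENNReal.ofReal (max (f ω) 0) ∂P := by
    simp
  rw [h, ← ofReal_integral_eq_lintegral_ofReal hf.pos_part (ae_of_all _ fun _ => le_max_right _ _)]
  exact ENNReal.ofReal_le_ofReal (integral_mono hf hf.pos_part fun _ => le_max_left _ _)

/-- Replacing `Z` by an independent copy changes the expectation of a `[0, 1]`-valued function of
`S + Z` by at most the `β`-coefficient of σ-algebras that carry `S` and `Z`. -/
theorem ofReal_integral_add_sub_le_betaCoef {Ω : Type*} {mU mV : MeasurableSpace Ω}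
    [mΩ : MeasurableSpace Ω] (P : Measure Ω) [IsProbabilityMeasure P] (hU : mU ≤ mΩ) (hV : mV ≤ mΩ)
    {S Z : Ω → ℝ} (hS : Measurable[mU] S) (hZ : Measurable[mV] Z) (R : Finset ℝ)
    (hR : ∀ ω, Z ω ∈ R) {φ : ℝ → ℝ} (hφ : Measurable φ) (h0 : ∀ x, 0 ≤ φ x) (h1 : ∀ x, φ x ≤ 1) :
    ENNReal.ofReal ((∫ ω, φ (S ω + Z ω) ∂P) -
      ∫ ω, (∑ z ∈ R, P.real (Z ⁻¹' {z}) * φ (S ω + z)) ∂P) ≤ betaCoef P mU mV := by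
  classical
  refine le_iInf fun g => le_iInf fun hg => le_iInf fun hgV => ?_
  have hS' : Measurable S := hS.mono hU le_rfl
  have hZ' : Measurable Z := hZ.mono hV le_rfl
  have hbd : ∀ x, ‖φ x‖ ≤ 1 := fun x => by
    rw [Real.norm_eq_abs, abs_of_nonneg (h0 x)]; exact h1 x
  have hset : ∀ D : Set ℝ, MeasurableSet D → MeasurableSet[mV] (Z ⁻¹' D) := fun D hD => hZ hD
  have hset' : ∀ D : Set ℝ, MeasurableSet D → MeasurableSet (Z ⁻¹' D) := fun D hD => hZ' hD
  set p : ℝ → Ω → ℝ := fun z => P[(Z ⁻¹' {z}).indicator (fun _ => (1 : ℝ)) | mU] with hp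
  have hpi : ∀ z, Integrable (p z) P := fun z => integrable_condExp
  have hone : ∀ D : Set ℝ, MeasurableSet D →
      Integrable ((Z ⁻¹' D).indicator (fun _ => (1 : ℝ))) P := fun D hD =>
    (integrable_const (1 : ℝ)).indicator (hset' D hD)
  have hφm : ∀ z, Measurable[mU] fun ω => φ (S ω + z) := fun z =>
    hφ.comp (hS.add_const z)
  have hφm' : ∀ z, Measurable fun ω => φ (S ω + z) := fun z => (hφm z).mono hU le_rfl
  have hmulint : ∀ z (f : Ω → ℝ), Integrable f P → Integrable (fun ω => φ (S ω + z) * f ω) P :=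
    fun z f hf => hf.bdd_mul (c := 1) (hφm' z).aestronglyMeasurable (ae_of_all _ fun ω => hbd _)
  have hpull : ∀ z, ∫ ω, φ (S ω + z) * (Z ⁻¹' {z}).indicator (fun _ => (1 : ℝ)) ω ∂P
      = ∫ ω, φ (S ω + z) * p z ω ∂P := by
    intro z
    have := condExp_mul_of_stronglyMeasurable_left (μ := P) (m := mU)
      (f := fun ω => φ (S ω + z)) (g := (Z ⁻¹' {z}).indicator (fun _ => (1 : ℝ)))
      (hφm z).stronglyMeasurable (hmulint z _ (hone _ (measurableSet_singleton z)))
      (hone _ (measurableSet_singleton z))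
    rw [← integral_condExp hU]
    exact integral_congr_ae this
  have hexp : ∀ ω, φ (S ω + Z ω)
      = ∑ z ∈ R, φ (S ω + z) * (Z ⁻¹' {z}).indicator (fun _ => (1 : ℝ)) ω := by
    intro ω
    rw [Finset.sum_eq_single (Z ω)]
    · simp
    · intro z _ hz
      have : ω ∉ Z ⁻¹' {z} := by simpa using fun h => hz h.symm
      simp [Set.indicator_of_notMem this]
    · exact fun h => (h (hR ω)).elim
  have hE : ∫ ω, φ (S ω + Z ω) ∂P = ∫ ω, ∑ z ∈ R, φ (S ω + z) * p z ω ∂P := by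
    simp_rw [hexp]
    rw [integral_finsetSum _ fun z _ => hmulint z _ (hone _ (measurableSet_singleton z)),
      integral_finsetSum _ fun z _ => hmulint z _ (hpi z)]
    exact Finset.sum_congr rfl fun z _ => hpull z
  have hI1 : Integrable (fun ω => ∑ z ∈ R, φ (S ω + z) * p z ω) P :=
    integrable_finsetSum _ fun z _ => hmulint z _ (hpi z)
  have hI2 : Integrable (fun ω => ∑ z ∈ R, P.real (Z ⁻¹' {z}) * φ (S ω + z)) P :=
    integrable_finsetSum _ fun z _ => by
      simpa [mul_comm] using hmulint z (fun _ => P.real (Z ⁻¹' {z})) (integrable_const _)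
  -- As `Z` has finitely many values, only finitely many events `Z ∈ D` occur, so one null set
  -- serves all of them and `D` may then depend on `ω`.
  have hae : ∀ᵐ ω ∂P, ∀ D ∈ R.powerset, ENNReal.ofReal
      (∑ z ∈ D, (p z ω - P.real (Z ⁻¹' {z}))) ≤ g ω := by
    refine (Filter.eventually_all_finset _).2 fun D _ => ?_
    have hDm : MeasurableSet (D : Set ℝ) := D.measurableSet
    have hsum : (Z ⁻¹' (D : Set ℝ)).indicator (fun _ => (1 : ℝ))
        = ∑ z ∈ D, (Z ⁻¹' {z}).indicator (fun _ => (1 : ℝ)) := by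
      ext ω
      simp [Set.indicator_apply]
    have hPD : P.real (Z ⁻¹' (D : Set ℝ)) = ∑ z ∈ D, P.real (Z ⁻¹' {z}) := by
      rw [← sum_measureReal_preimage_singleton]
      exact fun z _ => hset' _ (measurableSet_singleton z)
    have hc : P[(Z ⁻¹' (D : Set ℝ)).indicator (fun _ => (1 : ℝ)) | mU]
        =ᵐ[P] ∑ z ∈ D, p z := by
      rw [hsum]
      exact condExp_finsetSum (fun z _ => hone _ (measurableSet_singleton z)) mU
    filter_upwards [hc, hgV _ (hset _ hDm)] with ω h1 h2
    refine le_trans (ENNReal.ofReal_le_ofReal ?_) h2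
    rw [h1, hPD, Finset.sum_apply, Finset.sum_sub_distrib]
    exact le_abs_self _
  rw [hE, ← integral_sub hI1 hI2]
  refine le_trans (ofReal_integral_le_lintegral (hI1.sub hI2)) (lintegral_mono_ae ?_)
  filter_upwards [hae] with ω hω
  -- For weights `φ` in `[0, 1]` the sum is largest when `φ` is the indicator of the values whose
  -- conditional probability exceeds the unconditional one.
  refine le_trans (ENNReal.ofReal_le_ofReal ?_)
    (hω (R.filter fun z => 0 ≤ p z ω - P.real (Z ⁻¹' {z})) (by simp))
  rw [← Finset.sum_sub_distrib, Finset.sum_filter]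
  refine Finset.sum_le_sum fun z _ => ?_
  split_ifs with h
  · nlinarith [h0 (S ω + z), h1 (S ω + z)]
  · nlinarith [h0 (S ω + z), h1 (S ω + z)]


theorem betaCoef_bot {Ω : Type*} {mV : MeasurableSpace Ω} [mΩ : MeasurableSpace Ω] (P : Measure Ω)
    [IsProbabilityMeasure P] (hV : mV ≤ mΩ) : betaCoef P ⊥ mV = 0 := by
  refine le_antisymm ?_ zero_le
  have h0 : ∫⁻ _, (0 : ENNReal) ∂P = 0 := by simp
  rw [← h0]
  refine iInf₂_le_of_le (fun _ => 0) measurable_const <|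
    iInf_le_of_le (fun V hV' => ae_of_all _ fun ω => ?_) le_rfl
  rw [condExp_bot, integral_indicator_const _ (hV _ hV')]
  simp

/-- Each variable `W j` has `β`-coefficient at most `b` with the past `W i`, `i < j`. -/
def BetaChain {Ω : Type*} [mΩ : MeasurableSpace Ω] (P : Measure Ω) (W : ℕ → Ω → ℝ) (b : ℝ) : Prop :=
  ∀ j, ∃ mU mV : MeasurableSpace Ω, mU ≤ mΩ ∧ mV ≤ mΩ ∧ (∀ i < j, Measurable[mU] (W i)) ∧
    Measurable[mV] (W j) ∧ betaCoef (mΩ := mΩ) P mU mV ≤ ENNReal.ofReal b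

theorem BetaChain.comp {Ω : Type*} [MeasurableSpace Ω] {P : Measure Ω} {W : ℕ → Ω → ℝ} {b : ℝ}
    (h : BetaChain P W b) {f : ℝ → ℝ} (hf : Measurable f) :
    BetaChain P (fun j ω => f (W j ω)) b := fun j => by
  obtain ⟨mU, mV, hU, hV, h1, h2, h3⟩ := h j
  exact ⟨mU, mV, hU, hV, fun i hi => hf.comp (h1 i hi), hf.comp h2, h3⟩

theorem BetaChain.measurable {Ω : Type*} [MeasurableSpace Ω] {P : Measure Ω} {W : ℕ → Ω → ℝ} {b : ℝ}
    (h : BetaChain P W b) (j : ℕ) : Measurable (W j) := by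
  obtain ⟨mU, mV, hU, hV, h1, h2, h3⟩ := h j
  exact h2.mono hV le_rfl

theorem integral_eq_sum_of_mem {Ω : Type*} [MeasurableSpace Ω] (P : Measure Ω)
    [IsProbabilityMeasure P] {Z : Ω → ℝ} (hZ : Measurable Z) (R : Finset ℝ) (hR : ∀ ω, Z ω ∈ R)
    (f : ℝ → ℝ) : ∫ ω, f (Z ω) ∂P = ∑ z ∈ R, P.real (Z ⁻¹' {z}) * f z := by
  classical
  have hexp : ∀ ω, f (Z ω) = ∑ z ∈ R, (Z ⁻¹' {z}).indicator (fun _ => f z) ω := by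
    intro ω
    rw [Finset.sum_eq_single (Z ω)]
    · simp
    · intro z _ hz
      have : ω ∉ Z ⁻¹' {z} := by simpa using fun h => hz h.symm
      simp [Set.indicator_of_notMem this]
    · exact fun h => (h (hR ω)).elim
  have hm : ∀ z, MeasurableSet (Z ⁻¹' {z}) := fun z => hZ (measurableSet_singleton z)
  simp_rw [hexp]
  rw [integral_finsetSum _ fun z _ => (integrable_const (f z)).indicator (hm z)]
  refine Finset.sum_congr rfl fun z _ => ?_
  rw [integral_indicator_const _ (hm z), smul_eq_mul]

/-- Induction on the number of summands, with the test function `φ` free: averaging `φ (s + ·)` over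
the law of the last summand gives a new `[0, 1]`-valued test function, dominated by the same
exponential with `c` multiplied by one moment generating factor. Each replacement adds one `b`. -/
theorem integral_comp_sum_le_of_betaChain {Ω : Type*} [mΩ : MeasurableSpace Ω] (P : Measure Ω)
    [IsProbabilityMeasure P] {Z : ℕ → Ω → ℝ} {b : ℝ} (hb : 0 ≤ b) (hZ : BetaChain P Z b)
    (R : Finset ℝ) (hR : ∀ j ω, Z j ω ∈ R) (θ : ℝ) (n : ℕ) :
    ∀ (φ : ℝ → ℝ) (c : ℝ), Measurable φ → (∀ x, 0 ≤ φ x) → (∀ x, φ x ≤ 1) →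
      (∀ x, φ x ≤ c * Real.exp (θ * x)) →
      ∫ ω, φ (∑ j ∈ Finset.range n, Z j ω) ∂P ≤
        c * ∏ j ∈ Finset.range n, (∫ ω, Real.exp (θ * Z j ω) ∂P) + n * b := by
  induction n with
  | zero =>
    intro φ c _ _ _ h
    simpa using h 0
  | succ n ih =>
    intro φ c hφ h0 h1 hc
    have hstep : (∫ ω, φ (∑ j ∈ Finset.range n, Z j ω + Z n ω) ∂P) -
        ∫ ω, (∑ z ∈ R, P.real (Z n ⁻¹' {z}) * φ (∑ j ∈ Finset.range n, Z j ω + z)) ∂P ≤ b := by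
      obtain ⟨mU, mV, hU, hV, hpast, hfut, hβ⟩ := hZ n
      have hS : Measurable[mU] fun ω => ∑ j ∈ Finset.range n, Z j ω :=
        Finset.measurable_fun_sum _ fun j hj => hpast j (Finset.mem_range.1 hj)
      have h := (ofReal_integral_add_sub_le_betaCoef (mΩ := mΩ) P hU hV hS hfut R (hR n)
        hφ h0 h1).trans hβ
      rwa [ENNReal.ofReal_le_ofReal_iff hb] at h
    have hZn : Measurable (Z n) := hZ.measurable n
    have hsum : ∑ z ∈ R, P.real (Z n ⁻¹' {z}) = 1 := by
      have := integral_eq_sum_of_mem P hZn R (hR n) (fun _ => 1)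
      simpa using this.symm
    have hih := ih (fun s => ∑ z ∈ R, P.real (Z n ⁻¹' {z}) * φ (s + z))
      (c * ∫ ω, Real.exp (θ * Z n ω) ∂P)
      (Finset.measurable_fun_sum _ fun z _ => (hφ.comp (measurable_id.add_const z)).const_mul _)
      (fun s => Finset.sum_nonneg fun z _ => mul_nonneg measureReal_nonneg (h0 _))
      (fun s => by
        rw [← hsum]
        exact Finset.sum_le_sum fun z _ => mul_le_of_le_one_right measureReal_nonneg (h1 _))
      (fun s => by
        rw [integral_eq_sum_of_mem P hZn R (hR n) (fun z => Real.exp (θ * z)), Finset.mul_sum,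
          Finset.sum_mul]
        refine Finset.sum_le_sum fun z _ => ?_
        calc P.real (Z n ⁻¹' {z}) * φ (s + z)
            ≤ P.real (Z n ⁻¹' {z}) * (c * Real.exp (θ * (s + z))) :=
              mul_le_mul_of_nonneg_left (hc _) measureReal_nonneg
          _ = _ := by rw [mul_add, Real.exp_add]; ring)
    simp_rw [Finset.sum_range_succ]
    rw [Finset.prod_range_succ]
    push_cast
    linarith

theorem measureReal_le_sum_of_finite_range {Ω : Type*} [MeasurableSpace Ω] (P : Measure Ω)
    [IsProbabilityMeasure P] {Z : ℕ → Ω → ℝ} {b : ℝ} (hb : 0 ≤ b) (hZ : BetaChain P Z b)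
    (R : Finset ℝ) (hR : ∀ j ω, Z j ω ∈ R) {θ : ℝ} (hθ : 0 ≤ θ) (n : ℕ) (u : ℝ) :
    P.real {ω | u ≤ ∑ j ∈ Finset.range n, Z j ω} ≤
      Real.exp (-(θ * u)) * ∏ j ∈ Finset.range n, (∫ ω, Real.exp (θ * Z j ω) ∂P) + n * b := by
  have h := integral_comp_sum_le_of_betaChain P hb hZ R hR θ n
    ((Set.Ici u).indicator fun _ => 1) (Real.exp (-(θ * u)))
    (measurable_const.indicator measurableSet_Ici)
    (fun x => Set.indicator_nonneg (fun _ _ => zero_le_one) x)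
    (fun x => Set.indicator_le_self' (fun _ _ => zero_le_one) x)
    (fun x => by
      by_cases hx : x ∈ Set.Ici u
      · rw [Set.indicator_of_mem hx, ← Real.exp_add]
        have : u ≤ x := hx
        exact Real.one_le_exp (by nlinarith)
      · rw [Set.indicator_of_notMem hx]
        positivity)
  refine le_trans (le_of_eq ?_) h
  have hm : MeasurableSet {ω | u ≤ ∑ j ∈ Finset.range n, Z j ω} :=
    measurableSet_le measurable_const (Finset.measurable_fun_sum _ fun j _ => hZ.measurable j)
  rw [← integral_indicator_one hm]
  rfl

/-- Exponential tail bound for a sum of bounded variables with small `β`-coefficients. -/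
theorem measureReal_le_sum_of_betaChain {Ω : Type*} [MeasurableSpace Ω] (P : Measure Ω)
    [IsProbabilityMeasure P] {W : ℕ → Ω → ℝ} {b : ℝ} (hb : 0 ≤ b) (hW : BetaChain P W b)
    {B a v θ : ℝ} (hB : ∀ j ω, |W j ω| ≤ B) (ha : ∀ j, ∫ ω, W j ω ∂P ≤ a)
    (hv : ∀ j, ∫ ω, W j ω ^ 2 ∂P ≤ v) (hθ : 0 ≤ θ) (hθB : θ * B ≤ 1) (n : ℕ) (u : ℝ) :
    P.real {ω | u ≤ ∑ j ∈ Finset.range n, W j ω} ≤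
      Real.exp (-(θ * u) + n * (θ * a + θ ^ 2 * v)) + n * b := by
  have hWm := hW.measurable
  have hWi : ∀ j, Integrable (W j) P := fun j =>
    Integrable.of_bound (hWm j).aestronglyMeasurable B (ae_of_all _ fun ω => hB j ω)
  have hWi2 : ∀ j, Integrable (fun ω => W j ω ^ 2) P := fun j =>
    Integrable.of_bound ((hWm j).pow_const 2).aestronglyMeasurable (B ^ 2) (ae_of_all _ fun ω => by
      rw [Real.norm_eq_abs, abs_pow]
      exact pow_le_pow_left₀ (abs_nonneg _) (hB j ω) 2)
  have hsmall : ∀ j ω, |θ * W j ω| ≤ 1 := fun j ω => by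
    rw [abs_mul, abs_of_nonneg hθ]
    exact (mul_le_mul_of_nonneg_left (hB j ω) hθ).trans hθB
  have hmgf : ∀ j, ∫ ω, Real.exp (θ * W j ω) ∂P ≤ Real.exp (θ * a + θ ^ 2 * v) := by
    intro j
    have h1 : ∫ ω, Real.exp (θ * W j ω) ∂P ≤ ∫ ω, (1 + θ * W j ω + θ ^ 2 * W j ω ^ 2) ∂P := by
      refine integral_mono_of_nonneg (ae_of_all _ fun ω => (Real.exp_pos _).le)
        (((integrable_const _).add ((hWi j).const_mul _)).add ((hWi2 j).const_mul _))
        (ae_of_all _ fun ω => ?_)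
      have := (abs_le.1 (Real.abs_exp_sub_one_sub_id_le (hsmall j ω))).2
      simp only
      nlinarith
    have h2 : ∫ ω, (1 + θ * W j ω + θ ^ 2 * W j ω ^ 2) ∂P
        = 1 + θ * ∫ ω, W j ω ∂P + θ ^ 2 * ∫ ω, W j ω ^ 2 ∂P := by
      rw [integral_add (f := fun ω => 1 + θ * W j ω)
          ((integrable_const _).add ((hWi j).const_mul _)) ((hWi2 j).const_mul _),
        integral_add (integrable_const _) ((hWi j).const_mul _), integral_const_mul,
        integral_const_mul]
      simp
    have h3 := Real.add_one_le_exp (θ * a + θ ^ 2 * v)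
    have h4 := mul_le_mul_of_nonneg_left (ha j) hθ
    have h5 := mul_le_mul_of_nonneg_left (hv j) (sq_nonneg θ)
    linarith
  -- Decoupling was proved for finitely many values only, so the variables are rounded up to the
  -- grid `η ℤ`. Rounding up can only increase the sum, costs a factor `exp (θ η)` per summand, and
  -- disappears as `η → 0`.
  have key : ∀ η : ℝ, 0 < η → P.real {ω | u ≤ ∑ j ∈ Finset.range n, W j ω} ≤
      Real.exp (-(θ * u) + n * (θ * a + θ ^ 2 * v) + n * (θ * η)) + n * b := by
    intro η hη
    set f : ℝ → ℝ := fun x => η * ⌈x / η⌉ with hf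
    have hfm : Measurable f := by
      have : Measurable fun x : ℝ => ((⌈x / η⌉ : ℤ) : ℝ) :=
        (measurable_from_top (f := fun k : ℤ => (k : ℝ))).comp
          (Int.measurable_ceil.comp (measurable_id.div_const η))
      exact this.const_mul η
    have hf1 : ∀ x, x ≤ f x := fun x => by
      have := Int.le_ceil (x / η)
      rw [div_le_iff₀ hη] at this
      simp only [hf]; linarith
    have hf2 : ∀ x, f x ≤ x + η := fun x => by
      have := (Int.ceil_lt_add_one (x / η)).le
      have h2 := mul_le_mul_of_nonneg_left this hη.le
      have : η * (x / η + 1) = x + η := by field_simp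
      simp only [hf]; linarith
    set R : Finset ℝ := (Finset.Icc ⌈-B / η⌉ ⌈B / η⌉).image fun k : ℤ => η * (k : ℝ) with hRdef
    have hR : ∀ j ω, f (W j ω) ∈ R := fun j ω => by
      refine Finset.mem_image.2 ⟨⌈W j ω / η⌉, Finset.mem_Icc.2 ⟨?_, ?_⟩, rfl⟩
      · exact Int.ceil_le_ceil (div_le_div_of_nonneg_right (abs_le.1 (hB j ω)).1 hη.le)
      · exact Int.ceil_le_ceil (div_le_div_of_nonneg_right (abs_le.1 (hB j ω)).2 hη.le)
    have h := measureReal_le_sum_of_finite_range P hb (hW.comp hfm) R hR hθ n u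
    have hprod : ∏ j ∈ Finset.range n, (∫ ω, Real.exp (θ * f (W j ω)) ∂P)
        ≤ Real.exp (n * (θ * a + θ ^ 2 * v + θ * η)) := by
      rw [Real.exp_nat_mul, ← Finset.card_range n, ← Finset.prod_const, Finset.card_range]
      refine Finset.prod_le_prod (fun j _ => integral_nonneg fun ω => (Real.exp_pos _).le)
        fun j _ => ?_
      calc ∫ ω, Real.exp (θ * f (W j ω)) ∂P
          ≤ ∫ ω, Real.exp (θ * W j ω) * Real.exp (θ * η) ∂P := by
            refine integral_mono_of_nonneg (ae_of_all _ fun ω => (Real.exp_pos _).le) ?_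
              (ae_of_all _ fun ω => ?_)
            · refine Integrable.mul_const (Integrable.of_bound
                ((hWm j).const_mul θ).exp.aestronglyMeasurable (Real.exp 1)
                (ae_of_all _ fun ω => ?_)) _
              rw [Real.norm_eq_abs, Real.abs_exp]
              exact Real.exp_le_exp.2 (abs_le.1 (hsmall j ω)).2
            · simp only
              rw [← Real.exp_add, ← mul_add]
              exact Real.exp_le_exp.2 (mul_le_mul_of_nonneg_left (hf2 _) hθ)
        _ ≤ Real.exp (θ * a + θ ^ 2 * v + θ * η) := by
            rw [integral_mul_const, Real.exp_add _ (θ * η)]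
            exact mul_le_mul_of_nonneg_right (hmgf j) (Real.exp_pos _).le
    calc P.real {ω | u ≤ ∑ j ∈ Finset.range n, W j ω}
        ≤ P.real {ω | u ≤ ∑ j ∈ Finset.range n, f (W j ω)} :=
          measureReal_mono fun ω hω => le_trans hω (Finset.sum_le_sum fun j _ => hf1 _)
      _ ≤ _ := h
      _ ≤ Real.exp (-(θ * u)) * Real.exp (n * (θ * a + θ ^ 2 * v + θ * η)) + n * b := by
          gcongr
      _ = _ := by rw [← Real.exp_add]; congr 2; ring
  have hlim : Tendsto (fun η : ℝ =>
      Real.exp (-(θ * u) + n * (θ * a + θ ^ 2 * v) + n * (θ * η)) + n * b) (𝓝[>] 0)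
      (𝓝 (Real.exp (-(θ * u) + n * (θ * a + θ ^ 2 * v)) + n * b)) := by
    have : Continuous fun η : ℝ =>
      Real.exp (-(θ * u) + n * (θ * a + θ ^ 2 * v) + n * (θ * η)) + n * b := by fun_prop
    have h := (this.tendsto 0).mono_left (nhdsWithin_le_nhds (s := Set.Ioi 0))
    simpa using h
  exact ge_of_tendsto hlim (eventually_mem_nhdsWithin.mono fun η hη => key η hη)

/-! ### Truncation -/

/-- Truncation of a real number to `0` outside `[-B, B]`. -/
def trunc (B x : ℝ) : ℝ := if |x| ≤ B then x else 0

theorem measurable_trunc (B : ℝ) : Measurable (trunc B) :=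
  Measurable.ite (measurableSet_le continuous_abs.measurable measurable_const) measurable_id
    measurable_const

theorem abs_trunc_le {B : ℝ} (hB : 0 ≤ B) (x : ℝ) : |trunc B x| ≤ B := by
  unfold trunc; split_ifs with h <;> simp [h, hB]

theorem trunc_sq_le (B x : ℝ) : trunc B x ^ 2 ≤ x ^ 2 := by
  unfold trunc; split_ifs <;> simp [sq_nonneg]

theorem trunc_of_abs_le {B x : ℝ} (h : |x| ≤ B) : trunc B x = x := if_pos h

theorem abs_sub_trunc_le {B : ℝ} (hB : 0 < B) (x : ℝ) : |x - trunc B x| ≤ x ^ 2 / B := by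
  unfold trunc; split_ifs with h
  · simp; positivity
  · rw [le_div_iff₀ hB, ← sq_abs x, sub_zero]
    nlinarith [abs_nonneg x]

/-- If `x² ≤ n Q` with `x` outside the truncation range, the truncation error of `x` is controlled
by the fluctuation of `Q`. -/
theorem abs_sub_trunc_le_of_sq_le {M n m x Q s : ℝ} (hM : 1 ≤ M) (hn : 0 < n) (hm : m ≤ n)
    (hm0 : 0 ≤ m) (hs : s ≤ M) (hx : x ^ 2 ≤ n * Q) :
    |x - trunc (2 * M * n) x| ≤ (Q - m * s) ^ 2 / n := by
  unfold trunc; split_ifs with h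
  · simp; positivity
  · push Not at h
    have hMn : 0 < M * n := by positivity
    -- One factor `|x| > 2 M n` of `x²` is spent to get `2 M |x| ≤ Q`. Thus `Q` is far above `m s ≤
    -- M n`, and `Q - m s` dominates both `|x|` and `n`.
    have h1 : (2 * M * n) * |x| ≤ n * Q := by
      rw [← sq_abs] at hx
      nlinarith [abs_nonneg x]
    have h2 : 2 * M * |x| ≤ Q := by
      have : n * (2 * M * |x|) ≤ n * Q := by linarith
      exact le_of_mul_le_mul_left this hn
    have h3 : m * s ≤ M * n := by nlinarith
    have h4 : 2 * M * (2 * M * n) ≤ Q := le_trans (by gcongr) h2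
    have h5 : M * n ≤ M * (M * n) := by nlinarith
    have h6 : M * |x| ≤ Q - m * s := by linarith
    have h7 : |x| ≤ Q - m * s := le_trans (by nlinarith [abs_nonneg x]) h6
    have h8 : n ≤ Q - m * s := by nlinarith
    rw [sub_zero, le_div_iff₀ hn]
    nlinarith [abs_nonneg x]

/-! ### Blocks of time indices -/

/-- The blocks of length `ℓ` of the time indices; the remainder belongs to the last block. -/
def timeBlock {T : ℕ} (ℓ b : ℕ) : Finset (Fin T) :=
  Finset.univ.filter fun t => min ((t : ℕ) / ℓ) (T / ℓ - 1) = b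

theorem mem_timeBlock {T ℓ b : ℕ} {t : Fin T} :
    t ∈ timeBlock ℓ b ↔ min ((t : ℕ) / ℓ) (T / ℓ - 1) = b := by
  simp [timeBlock]

/-- The hypothesis `2 ≤ ℓ` makes the endpoints distinct, as the block variance condition requires.
The last block absorbs the remainder, hence the length bound `2 ℓ`. -/
theorem timeBlock_eq_empty_or_Icc {T ℓ : ℕ} (hℓ : 2 ≤ ℓ) (hT : ℓ ≤ T) (b : ℕ) :
    (timeBlock ℓ b : Finset (Fin T)) = ∅ ∨ ∃ a c : Fin T, a < c ∧ timeBlock ℓ b = Finset.Icc a c ∧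
      (c : ℕ) + 1 ≤ a + 2 * ℓ := by
  have hN : 1 ≤ T / ℓ := Nat.div_pos hT (by omega)
  have hT1 : T / ℓ * ℓ ≤ T := Nat.div_mul_le_self T ℓ
  have hT2 : T < (T / ℓ + 1) * ℓ := Nat.lt_mul_of_div_lt (Nat.lt_succ_self _) (by omega)
  set N := T / ℓ with hNdef
  rcases lt_or_ge b N with hb | hb
  swap
  · left
    refine Finset.eq_empty_of_forall_notMem fun t ht => ?_
    rw [mem_timeBlock] at ht
    omega
  right
  have hbT : (b + 1) * ℓ ≤ T := (Nat.mul_le_mul_right ℓ hb).trans hT1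
  rw [add_mul, one_mul] at hbT
  rcases Nat.lt_or_ge (b + 1) N with hb1 | hb1
  · refine ⟨⟨b * ℓ, by omega⟩, ⟨b * ℓ + ℓ - 1, by omega⟩, ?_, ?_, ?_⟩
    · rw [Fin.lt_def]; simp only; omega
    · ext t
      rw [mem_timeBlock, Finset.mem_Icc, Fin.le_def, Fin.le_def]
      simp only
      have h1 : b ≤ (t : ℕ) / ℓ ↔ b * ℓ ≤ t := Nat.le_div_iff_mul_le (by omega)
      have h2 : (t : ℕ) / ℓ < b + 1 ↔ (t : ℕ) < (b + 1) * ℓ := Nat.div_lt_iff_lt_mul (by omega)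
      rw [add_mul, one_mul] at h2
      omega
    · simp only; omega
  · have hbN : b + 1 = N := by omega
    have hT2' : T < b * ℓ + 2 * ℓ := by
      rw [← hbN] at hT2
      calc T < _ := hT2
        _ = _ := by ring
    refine ⟨⟨b * ℓ, by omega⟩, ⟨T - 1, by omega⟩, ?_, ?_, ?_⟩
    · rw [Fin.lt_def]; simp only; omega
    · ext t
      rw [mem_timeBlock, Finset.mem_Icc, Fin.le_def, Fin.le_def]
      simp only
      have h1 : b ≤ (t : ℕ) / ℓ ↔ b * ℓ ≤ t := Nat.le_div_iff_mul_le (by omega)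
      have := t.2
      omega
    · simp only; omega

theorem card_timeBlock_le {T ℓ : ℕ} (hℓ : 2 ≤ ℓ) (hT : ℓ ≤ T) (b : ℕ) :
    (timeBlock ℓ b : Finset (Fin T)).card ≤ 2 * ℓ := by
  rcases timeBlock_eq_empty_or_Icc hℓ hT b with h | ⟨a, c, _, h, hac⟩
  · simp [h]
  · rw [h, Fin.card_Icc]
    omega

/-- Only `T / ℓ` blocks are nonempty; running over twice as many indices gives both parities the
same number of terms, the extra ones being empty sums. -/
theorem sum_eq_sum_timeBlock {T ℓ : ℕ} (hℓ : 0 < ℓ) (hT : ℓ ≤ T) (f : Fin T → ℝ) :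
    ∑ t, f t = ∑ j ∈ Finset.range (T / ℓ), ∑ t ∈ timeBlock ℓ (2 * j), f t +
      ∑ j ∈ Finset.range (T / ℓ), ∑ t ∈ timeBlock ℓ (2 * j + 1), f t := by
  have hN : 1 ≤ T / ℓ := Nat.div_pos hT hℓ
  have h1 : ∑ t, f t = ∑ b ∈ Finset.range (2 * (T / ℓ)), ∑ t ∈ timeBlock ℓ b, f t :=
    (Finset.sum_fiberwise_of_maps_to (fun t _ => Finset.mem_range.2 (by omega)) f).symm
  have h2 : ∀ (F : ℕ → ℝ) (n : ℕ), ∑ b ∈ Finset.range (2 * n), F b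
      = ∑ j ∈ Finset.range n, F (2 * j) + ∑ j ∈ Finset.range n, F (2 * j + 1) := by
    intro F n
    induction n with
    | zero => simp
    | succ n ih =>
      rw [mul_add, mul_one, Finset.sum_range_succ, Finset.sum_range_succ, ih,
        Finset.sum_range_succ, Finset.sum_range_succ]
      ring
  rw [h1, h2]

theorem measurable_sigmaOf {Ω : Type*} {T : ℕ} (Y : Fin T → Ω → ℝ) {p : ℕ → Prop}
    {t : Fin T} (ht : p t) : Measurable[sigmaOf Y p] (Y t) := by
  refine Measurable.mono (comap_measurable (Y t)) ?_ le_rfl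
  exact le_iSup₂_of_le t ht le_rfl

theorem sigmaOf_le {Ω : Type*} [mΩ : MeasurableSpace Ω] {T : ℕ} {Y : Fin T → Ω → ℝ}
    (hY : ∀ t, Measurable (Y t)) (p : ℕ → Prop) : sigmaOf Y p ≤ mΩ :=
  iSup₂_le fun t _ => (hY t).comap_le

theorem betaChain_block {Ω : Type*} [mΩ : MeasurableSpace Ω] (P : Measure Ω)
    [IsProbabilityMeasure P] {T : ℕ} {Y : Fin T → Ω → ℝ} (hY : ∀ t, Measurable (Y t)) {k ℓ : ℕ}
    {b : ℝ} (hβ : betaMix P Y k ≤ ENNReal.ofReal b) (hk : k ≤ ℓ) (hℓ : 0 < ℓ) (hT : ℓ ≤ T) (c : ℝ)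
    (p : ℕ) :
    BetaChain P (fun j ω => ∑ t ∈ timeBlock ℓ (2 * j + p), (Y t ω - c)) b := by
  have hN : 1 ≤ T / ℓ := Nat.div_pos hT hℓ
  intro j
  rcases Nat.eq_zero_or_pos j with rfl | hj
  · refine ⟨⊥, mΩ, bot_le, le_rfl, by simp, ?_, ?_⟩
    · exact Finset.measurable_fun_sum _ fun t _ => (hY t).sub_const c
    · rw [betaCoef_bot P le_rfl]
      exact zero_le
  -- The cut is at the end of the last block of the past: the block skipped between past and present
  -- has length `ℓ ≥ k`. Otherwise the present block is empty and any cut after all times will do.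
  set m : ℕ := if 2 * j + p < T / ℓ then (2 * j + p - 1) * ℓ else T with hm
  refine ⟨sigmaOf Y fun t => t ≤ m, sigmaOf Y fun t => m + k ≤ t, sigmaOf_le hY _, sigmaOf_le hY _,
    fun i hi => ?_, ?_, (le_iSup _ m).trans hβ⟩
  · refine Finset.measurable_fun_sum _ fun t ht => (measurable_sigmaOf Y ?_).sub_const c
    rw [mem_timeBlock] at ht
    rw [hm]
    have htT := t.2
    split_ifs with h
    · have h1 : (t : ℕ) / ℓ < 2 * j + p - 1 := by omega
      exact ((Nat.div_lt_iff_lt_mul hℓ).1 h1).le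
    · exact htT.le
  · refine Finset.measurable_fun_sum _ fun t ht => (measurable_sigmaOf Y ?_).sub_const c
    rw [mem_timeBlock] at ht
    have h : 2 * j + p < T / ℓ := by omega
    rw [hm, if_pos h]
    have h1 : 2 * j + p ≤ (t : ℕ) / ℓ := by omega
    have h2 := (Nat.le_div_iff_mul_le hℓ).1 h1
    have h3 : 2 * j + p = 2 * j + p - 1 + 1 := by omega
    rw [h3, add_mul, one_mul] at h2
    omega

/-- Exponential tail bound for the sum of a `β`-mixing sequence whose block sums are bounded, in
terms of the first two moments of the truncated block sums. -/
theorem measureReal_block_tail {Ω : Type*} [MeasurableSpace Ω] (P : Measure Ω)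
    [IsProbabilityMeasure P] {T : ℕ} {Y : Fin T → Ω → ℝ} (hY : ∀ t, Measurable (Y t)) {k ℓ : ℕ}
    {b : ℝ} (hb : 0 ≤ b) (hβ : betaMix P Y k ≤ ENNReal.ofReal b) (hk : k ≤ ℓ) (hℓ : 0 < ℓ)
    (hT : ℓ ≤ T) (c : ℝ) {B a v θ : ℝ} (hB : 0 ≤ B)
    (ha : ∀ j, |∫ ω, trunc B (∑ t ∈ timeBlock ℓ j, (Y t ω - c)) ∂P| ≤ a)
    (hv : ∀ j, ∫ ω, trunc B (∑ t ∈ timeBlock ℓ j, (Y t ω - c)) ^ 2 ∂P ≤ v) (hθ : 0 ≤ θ)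
    (hθB : θ * B ≤ 1) (u : ℝ) :
    P.real {ω | (∀ j, |∑ t ∈ timeBlock ℓ j, (Y t ω - c)| ≤ B) ∧ u ≤ |∑ t, (Y t ω - c)|} ≤
      4 * (Real.exp (-(θ * (u / 2)) + (T / ℓ : ℕ) * (θ * a + θ ^ 2 * v)) + (T / ℓ : ℕ) * b) := by
  set S : ℕ → Ω → ℝ := fun j ω => ∑ t ∈ timeBlock ℓ j, (Y t ω - c) with hS
  have hpos : ∀ p, P.real {ω | u / 2 ≤ ∑ j ∈ Finset.range (T / ℓ), trunc B (S (2 * j + p) ω)} ≤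
      Real.exp (-(θ * (u / 2)) + (T / ℓ : ℕ) * (θ * a + θ ^ 2 * v)) + (T / ℓ : ℕ) * b := fun p =>
    measureReal_le_sum_of_betaChain P hb
      ((betaChain_block P hY hβ hk hℓ hT c p).comp (measurable_trunc B))
      (fun j ω => abs_trunc_le hB _) (fun j => (le_abs_self _).trans (ha _)) (fun j => hv _)
      hθ hθB _ _
  have hneg : ∀ p, P.real {ω | u / 2 ≤ ∑ j ∈ Finset.range (T / ℓ), -trunc B (S (2 * j + p) ω)} ≤
      Real.exp (-(θ * (u / 2)) + (T / ℓ : ℕ) * (θ * a + θ ^ 2 * v)) + (T / ℓ : ℕ) * b := fun p =>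
    measureReal_le_sum_of_betaChain P hb
      ((betaChain_block P hY hβ hk hℓ hT c p).comp (f := fun x => -trunc B x)
        (measurable_trunc B).neg)
      (fun j ω => by rw [abs_neg]; exact abs_trunc_le hB _)
      (fun j => by rw [integral_neg]; exact (neg_le_abs _).trans (ha _))
      (fun j => by simp_rw [neg_sq]; exact hv _) hθ hθB _ _
  -- A large sum forces one of the two parities to contribute at least `u / 2`, with one of two
  -- signs: this is the factor `4`.
  have hsub : {ω | (∀ j, |S j ω| ≤ B) ∧ u ≤ |∑ t, (Y t ω - c)|} ⊆
      ({ω | u / 2 ≤ ∑ j ∈ Finset.range (T / ℓ), trunc B (S (2 * j + 0) ω)} ∪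
        {ω | u / 2 ≤ ∑ j ∈ Finset.range (T / ℓ), trunc B (S (2 * j + 1) ω)}) ∪
      ({ω | u / 2 ≤ ∑ j ∈ Finset.range (T / ℓ), -trunc B (S (2 * j + 0) ω)} ∪
        {ω | u / 2 ≤ ∑ j ∈ Finset.range (T / ℓ), -trunc B (S (2 * j + 1) ω)}) := by
    rintro ω ⟨h1, h2⟩
    have hsum := sum_eq_sum_timeBlock hℓ hT fun t => Y t ω - c
    simp only [Set.mem_union, Set.mem_ofPred_eq, trunc_of_abs_le (h1 _), Finset.sum_neg_distrib,
      add_zero]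
    rw [hsum] at h2
    by_contra! hcon
    obtain ⟨⟨h3, h4⟩, h5, h6⟩ := hcon
    rcases le_abs.1 h2 with h | h <;> linarith
  calc _ ≤ _ := measureReal_mono hsub
    _ ≤ _ := measureReal_union_le _ _
    _ ≤ _ := add_le_add (measureReal_union_le _ _) (measureReal_union_le _ _)
    _ ≤ _ := by linarith [hpos 0, hpos 1, hneg 0, hneg 1]

theorem abs_integral_trunc_le {Ω : Type*} [MeasurableSpace Ω] (P : Measure Ω)
    [IsProbabilityMeasure P] {W : Ω → ℝ} (hW : Integrable W P) (h0 : ∫ ω, W ω ∂P = 0) {B : ℝ}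
    {g : Ω → ℝ} (hg : Integrable g P) (h : ∀ ω, |W ω - trunc B (W ω)| ≤ g ω) :
    |∫ ω, trunc B (W ω) ∂P| ≤ ∫ ω, g ω ∂P := by
  have ht : Integrable (fun ω => trunc B (W ω)) P := by
    refine Integrable.mono hW
      ((measurable_trunc B).comp_aemeasurable hW.1.aemeasurable).aestronglyMeasurable
      (ae_of_all _ fun ω => ?_)
    simp only [trunc]
    split_ifs <;> simp
  have h1 : ∫ ω, trunc B (W ω) ∂P = -∫ ω, (W ω - trunc B (W ω)) ∂P := by
    rw [integral_sub hW ht, h0]; ring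
  rw [h1, abs_neg]
  refine (abs_integral_le_integral_abs).trans (integral_mono (hW.sub ht).abs hg h)

theorem integral_trunc_sq_le {Ω : Type*} [MeasurableSpace Ω] (P : Measure Ω)
    {W : Ω → ℝ} (hW : MemLp W 2 P) (B : ℝ) :
    ∫ ω, trunc B (W ω) ^ 2 ∂P ≤ ∫ ω, W ω ^ 2 ∂P :=
  integral_mono_of_nonneg (ae_of_all _ fun _ => sq_nonneg _) hW.integrable_sq
    (ae_of_all _ fun _ => trunc_sq_le _ _)

/-! ### Moments and tails of block sums -/

namespace Admissible

variable {Ω : Type*} [MeasurableSpace Ω] {P : Measure Ω} {J T : ℕ}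
  {X : Fin T → Fin J → Ω → ℝ} {S : Matrix (Fin J) (Fin J) ℝ} {σ M ρ : ℝ} {k : ℕ} {b : ℝ}

theorem memLp_prod (h : Admissible P X S σ M ρ k b) (t : Fin T) (i j : Fin J) :
    MemLp (fun ω => X t i ω * X t j ω) 2 P := by
  have : ENNReal.HolderTriple 4 4 2 := ⟨by
    rw [show (4 : ENNReal) = 2 * 2 by norm_num, ENNReal.mul_inv (by simp) (by simp), ← mul_add,
      ENNReal.inv_two_add_inv_two, mul_one]⟩
  exact (h.memLp t j).mul (h.memLp t i)

theorem integral_sq (h : Admissible P X S σ M ρ k b) (t : Fin T) (i : Fin J) :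
    ∫ ω, X t i ω ^ 2 ∂P = S i i := by
  rw [← h.cov t i i]; simp_rw [sq]

theorem integral_block_prod_sq_le (h : Admissible P X S σ M ρ k b) {ℓ : ℕ} (hℓ : 2 ≤ ℓ)
    (hT : ℓ ≤ T) (n : ℕ) (i j : Fin J) :
    ∫ ω, (∑ t ∈ timeBlock ℓ n, (X t i ω * X t j ω - S i j)) ^ 2 ∂P ≤ 2 * ℓ * σ ^ 2 := by
  rcases timeBlock_eq_empty_or_Icc hℓ hT n with he | ⟨a, c, hac, he, hle⟩
  · simp only [he, Finset.sum_empty]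
    simp only [ne_eq, OfNat.ofNat_ne_zero, not_false_eq_true, zero_pow, integral_zero]
    positivity
  · have hb := h.block i j a c hac
    have hac' : (a : ℝ) < c := by exact_mod_cast Fin.lt_def.1 hac
    have hle' : (c : ℝ) + 1 ≤ a + 2 * ℓ := by exact_mod_cast hle
    rw [inv_mul_le_iff₀ (by linarith)] at hb
    rw [he]
    refine hb.trans ?_
    nlinarith [sq_nonneg σ]

variable [IsProbabilityMeasure P]

theorem memLp_two (h : Admissible P X S σ M ρ k b) (t : Fin T) (i : Fin J) :
    MemLp (X t i) 2 P := (h.memLp t i).mono_exponent (by norm_num)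

theorem memLp_block_prod (h : Admissible P X S σ M ρ k b) (ℓ n : ℕ) (i j : Fin J) :
    MemLp (fun ω => ∑ t ∈ timeBlock ℓ n, (X t i ω * X t j ω - S i j)) 2 P :=
  memLp_finsetSum _ fun t _ => (h.memLp_prod t i j).sub (memLp_const _)

theorem memLp_block (h : Admissible P X S σ M ρ k b) (ℓ n : ℕ) (i : Fin J) :
    MemLp (fun ω => ∑ t ∈ timeBlock ℓ n, (X t i ω - 0)) 2 P :=
  memLp_finsetSum _ fun t _ => (h.memLp_two t i).sub (memLp_const _)

theorem integral_block_prod (h : Admissible P X S σ M ρ k b) (ℓ n : ℕ) (i j : Fin J) :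
    ∫ ω, ∑ t ∈ timeBlock ℓ n, (X t i ω * X t j ω - S i j) ∂P = 0 := by
  have hi : ∀ t, Integrable (fun ω => X t i ω * X t j ω) P := fun t =>
    (h.memLp_prod t i j).integrable (by norm_num)
  rw [integral_finsetSum (f := fun t ω => X t i ω * X t j ω - S i j) _
    fun t _ => (hi t).sub (integrable_const _)]
  refine Finset.sum_eq_zero fun t _ => ?_
  rw [integral_sub (hi t) (integrable_const _), h.cov]
  simp

theorem integral_block (h : Admissible P X S σ M ρ k b) (ℓ n : ℕ) (i : Fin J) :
    ∫ ω, ∑ t ∈ timeBlock ℓ n, (X t i ω - 0) ∂P = 0 := by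
  have hi : ∀ t, Integrable (X t i) P := fun t => (h.memLp_two t i).integrable (by norm_num)
  simp_rw [sub_zero]
  rw [integral_finsetSum _ fun t _ => hi t]
  exact Finset.sum_eq_zero fun t _ => h.mean_zero t i

theorem abs_cov_le (h : Admissible P X S σ M ρ k b) (hT : 0 < T) {M₁ : ℝ}
    (hS : ∀ i, S i i ≤ M₁) (i j : Fin J) : |S i j| ≤ M₁ := by
  let t : Fin T := ⟨0, hT⟩
  have h2 : ∀ i, Integrable (fun ω => X t i ω ^ 2) P := fun i => (h.memLp_two t i).integrable_sq
  have h1 : |S i j| ≤ ∫ ω, (X t i ω ^ 2 + X t j ω ^ 2) / 2 ∂P := by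
    rw [← h.cov t i j]
    refine abs_integral_le_integral_abs.trans (integral_mono
      ((h.memLp_prod t i j).integrable (by norm_num)).abs
      (((h2 i).add (h2 j)).div_const 2) fun ω => ?_)
    simp only []
    rw [abs_mul, ← sq_abs (X t i ω), ← sq_abs (X t j ω)]
    nlinarith [sq_nonneg (|X t i ω| - |X t j ω|)]
  rw [integral_div, integral_add (h2 i) (h2 j), h.integral_sq, h.integral_sq] at h1
  linarith [hS i, hS j]

/-- Plain Cauchy–Schwarz over at most `2 ℓ` indices, since no variance condition is imposed on sums
of coordinates. -/
theorem integral_block_sq_le (h : Admissible P X S σ M ρ k b) {M₁ : ℝ}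
    (hS : ∀ i, S i i ≤ M₁) {ℓ : ℕ} (hℓ : 2 ≤ ℓ) (hT : ℓ ≤ T) (n : ℕ) (i : Fin J) :
    ∫ ω, (∑ t ∈ timeBlock ℓ n, (X t i ω - 0)) ^ 2 ∂P ≤ 4 * ℓ ^ 2 * M₁ := by
  have hc : ((timeBlock ℓ n : Finset (Fin T)).card : ℝ) ≤ 2 * ℓ := by
    exact_mod_cast card_timeBlock_le hℓ hT n
  have hi : ∀ t, Integrable (fun ω => X t i ω ^ 2) P := fun t => (h.memLp_two t i).integrable_sq
  have hS0 : ∀ i, 0 ≤ S i i := fun i => by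
    rw [← h.integral_sq ⟨0, by omega⟩ i]
    exact integral_nonneg fun ω => sq_nonneg _
  calc ∫ ω, (∑ t ∈ timeBlock ℓ n, (X t i ω - 0)) ^ 2 ∂P
      ≤ ∫ ω, ((timeBlock ℓ n : Finset (Fin T)).card : ℝ) * ∑ t ∈ timeBlock ℓ n, X t i ω ^ 2 ∂P := by
        refine integral_mono (h.memLp_block ℓ n i).integrable_sq
          ((integrable_finsetSum _ fun t _ => hi t).const_mul _) fun ω => ?_
        simp only [sub_zero]
        exact sq_sum_le_card_mul_sum_sq
    _ = (timeBlock ℓ n : Finset (Fin T)).card * ((timeBlock ℓ n : Finset (Fin T)).card * S i i) := by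
        rw [integral_const_mul, integral_finsetSum _ fun t _ => hi t]
        simp [h.integral_sq]
    _ ≤ (2 * ℓ) * ((2 * ℓ) * M₁) := by
        have h0 : 0 ≤ (2 * ℓ : ℝ) := by positivity
        exact mul_le_mul hc (mul_le_mul hc (hS i) (hS0 i) h0)
          (mul_nonneg (Nat.cast_nonneg _) (hS0 i)) h0
    _ = _ := by ring

theorem abs_integral_trunc_block_prod_le (h : Admissible P X S σ M ρ k b) {M₁ : ℝ}
    (hM₁ : 1 ≤ M₁) {ℓ : ℕ} (hℓ : 2 ≤ ℓ) (hT : ℓ ≤ T) (n : ℕ) (i j : Fin J) :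
    |∫ ω, trunc (2 * M₁ * (2 * ℓ)) (∑ t ∈ timeBlock ℓ n, (X t i ω * X t j ω - S i j)) ∂P| ≤ σ ^ 2 := by
  have hℓ' : (2 : ℝ) ≤ ℓ := by exact_mod_cast hℓ
  have hm := h.memLp_block_prod ℓ n i j
  have hB : 0 < 2 * M₁ * (2 * ℓ) := by positivity
  refine (abs_integral_trunc_le P (hm.integrable (by norm_num)) (h.integral_block_prod ℓ n i j)
    (hm.integrable_sq.div_const _) fun ω => abs_sub_trunc_le hB _).trans ?_
  rw [integral_div, div_le_iff₀ hB]
  refine (h.integral_block_prod_sq_le hℓ hT n i j).trans ?_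
  have : (ℓ : ℝ) ≤ M₁ * ℓ := by nlinarith
  nlinarith [sq_nonneg σ]

/-- By Cauchy–Schwarz the squared block sum is at most `2 ℓ` times the block sum of squares. A block
sum outside the truncation range therefore forces the squares to deviate from their mean, and the
variance condition for the product `Xₜᵢ Xₜᵢ` bounds the bias by a constant, where the crude second
moment would only give order `ℓ`. -/
theorem abs_integral_trunc_block_le (h : Admissible P X S σ M ρ k b) {M₁ : ℝ}
    (hM₁ : 1 ≤ M₁) (hS : ∀ i, S i i ≤ M₁) {ℓ : ℕ} (hℓ : 2 ≤ ℓ) (hT : ℓ ≤ T) (n : ℕ) (i : Fin J) :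
    |∫ ω, trunc (2 * M₁ * (2 * ℓ)) (∑ t ∈ timeBlock ℓ n, (X t i ω - 0)) ∂P| ≤ σ ^ 2 := by
  have hℓ' : (2 : ℝ) ≤ ℓ := by exact_mod_cast hℓ
  have hm := h.memLp_block_prod ℓ n i i
  have hc : ((timeBlock ℓ n : Finset (Fin T)).card : ℝ) ≤ 2 * ℓ := by
    exact_mod_cast card_timeBlock_le hℓ hT n
  refine (abs_integral_trunc_le P ((h.memLp_block ℓ n i).integrable (by norm_num))
    (h.integral_block ℓ n i) (hm.integrable_sq.div_const (2 * ℓ)) fun ω => ?_).trans ?_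
  · have hQ : ∑ t ∈ timeBlock ℓ n, (X t i ω * X t i ω - S i i) = ∑ t ∈ timeBlock ℓ n, X t i ω ^ 2 -
        (timeBlock ℓ n : Finset (Fin T)).card * S i i := by
      simp [Finset.sum_sub_distrib, sq]
    rw [hQ]
    refine abs_sub_trunc_le_of_sq_le hM₁ (by positivity) hc (Nat.cast_nonneg _) (hS i) ?_
    simp only [sub_zero]
    refine (sq_sum_le_card_mul_sum_sq).trans ?_
    gcongr
  · rw [integral_div, div_le_iff₀ (by positivity)]
    linarith [h.integral_block_prod_sq_le hℓ hT n i i]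

/-- Tail bound for the centred sums of products on the event that all products are bounded. -/
theorem measureReal_prod_tail (h : Admissible P X S σ M ρ k b) {M₁ : ℝ} (hM : M ≤ M₁)
    (hM₁ : 1 ≤ M₁) (hS : ∀ i, S i i ≤ M₁) {ℓ : ℕ} (hℓ : 2 ≤ ℓ) (hT : ℓ ≤ T) (hk : k ≤ ℓ)
    {b' : ℝ} (hb' : 0 ≤ b') (hbb : b ≤ b') {θ : ℝ} (hθ : 0 ≤ θ)
    (hθB : θ * (2 * M₁ * (2 * ℓ)) ≤ 1) (u : ℝ) (i j : Fin J) :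
    P.real {ω | (∀ t i j, |X t i ω * X t j ω| ≤ M) ∧ u ≤ |∑ t, (X t i ω * X t j ω - S i j)|} ≤
      4 * (Real.exp (-(θ * (u / 2)) + (T / ℓ : ℕ) * (θ * σ ^ 2 + θ ^ 2 * (2 * ℓ * σ ^ 2))) +
        (T / ℓ : ℕ) * b') := by
  refine le_trans (measureReal_mono (fun ω hω => And.intro (fun n => ?_) hω.2))
    (measureReal_block_tail P (fun t => (h.measurable t i).mul (h.measurable t j)) hb'
      ((h.mixing_prod i j).trans (ENNReal.ofReal_le_ofReal hbb)) hk (by omega) hT (S i j)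
      (B := 2 * M₁ * (2 * ℓ)) (by positivity)
      (fun n => h.abs_integral_trunc_block_prod_le hM₁ hℓ hT n i j)
      (fun n => (integral_trunc_sq_le P (h.memLp_block_prod ℓ n i j) _).trans
        (h.integral_block_prod_sq_le hℓ hT n i j)) hθ hθB u)
  have hc : ((timeBlock ℓ n : Finset (Fin T)).card : ℝ) ≤ 2 * ℓ := by
    exact_mod_cast card_timeBlock_le hℓ hT n
  refine (Finset.abs_sum_le_sum_abs _ _).trans ((Finset.sum_le_card_nsmul _ _ (2 * M₁)
    fun t _ => ?_).trans ?_)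
  · refine (abs_sub (X t i ω * X t j ω) _).trans ?_
    linarith [hω.1 t i j, h.abs_cov_le (by omega) hS i j]
  · rw [nsmul_eq_mul]
    nlinarith

/-- Tail bound for the sums of a coordinate on the event that all products are bounded. -/
theorem measureReal_coord_tail (h : Admissible P X S σ M ρ k b) {M₁ : ℝ} (hM : M ≤ M₁)
    (hM₁ : 1 ≤ M₁) (hS : ∀ i, S i i ≤ M₁) {ℓ : ℕ} (hℓ : 2 ≤ ℓ) (hT : ℓ ≤ T) (hk : k ≤ ℓ)
    {b' : ℝ} (hb' : 0 ≤ b') (hbb : b ≤ b') {θ : ℝ} (hθ : 0 ≤ θ)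
    (hθB : θ * (2 * M₁ * (2 * ℓ)) ≤ 1) (u : ℝ) (i : Fin J) :
    P.real {ω | (∀ t i j, |X t i ω * X t j ω| ≤ M) ∧ u ≤ |∑ t, X t i ω|} ≤
      4 * (Real.exp (-(θ * (u / 2)) + (T / ℓ : ℕ) * (θ * σ ^ 2 + θ ^ 2 * (4 * ℓ ^ 2 * M₁))) +
        (T / ℓ : ℕ) * b') := by
  refine le_trans (measureReal_mono (fun ω hω => And.intro (fun n => ?_) ?_))
    (measureReal_block_tail P (fun t => h.measurable t i) hb'
      ((h.mixing_coord i).trans (ENNReal.ofReal_le_ofReal hbb)) hk (by omega) hT 0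
      (B := 2 * M₁ * (2 * ℓ)) (by positivity)
      (fun n => h.abs_integral_trunc_block_le hM₁ hS hℓ hT n i)
      (fun n => (integral_trunc_sq_le P (h.memLp_block ℓ n i) _).trans
        (h.integral_block_sq_le hS hℓ hT n i)) hθ hθB u)
  · have hc : ((timeBlock ℓ n : Finset (Fin T)).card : ℝ) ≤ 2 * ℓ := by
      exact_mod_cast card_timeBlock_le hℓ hT n
    refine (Finset.abs_sum_le_sum_abs _ _).trans ((Finset.sum_le_card_nsmul _ _ (2 * M₁)
      fun t _ => ?_).trans ?_)
    · have := hω.1 t i i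
      rw [abs_mul] at this
      rw [sub_zero]
      nlinarith [abs_nonneg (X t i ω)]
    · rw [nsmul_eq_mul]
      nlinarith
  · simpa using hω.2

end Admissible

/-! ### Numerical estimates for the exponents and the union bound -/

/-- Here `x = 1/w`, `f = ⌊x⌋`, `L = log J`, `s = σ²`, and the Chernoff parameter is `1 / (4 M ℓ)`
with `ℓ = lam f`. The main term is at least `lam L (2 s + 44)`; bias and variance cost at most `L s`
each. -/
theorem prod_exponent_le {M lam L x f N s : ℝ} (hM : 1 ≤ M) (hlam : 1 ≤ lam) (hL : 0 < L)
    (hf : 0 < f) (hfx : f ≤ x) (hxf : x ≤ 2 * f) (hN : N ≤ L * x ^ 2 / (lam * f)) (hs : 0 ≤ s) :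
    -((4 * M * (lam * f))⁻¹ * (lam ^ 2 * (16 * M * (2 * s + 44)) * L * x / 2 / 2)) +
      N * ((4 * M * (lam * f))⁻¹ * s + (4 * M * (lam * f))⁻¹ ^ 2 * (2 * (lam * f) * s)) ≤
      -(4 * lam * L) := by
  set z := x / f with hz
  have hz1 : 1 ≤ z := (one_le_div hf).2 hfx
  have hz2 : z ≤ 2 := (div_le_iff₀ hf).2 hxf
  have hx : x = z * f := by rw [hz]; field_simp
  have hc : 0 ≤ (4 * M * (lam * f))⁻¹ * s + (4 * M * (lam * f))⁻¹ ^ 2 * (2 * (lam * f) * s) := by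
    positivity
  have h1 := mul_le_mul_of_nonneg_right hN hc
  have h2 : L * x ^ 2 / (lam * f) *
      ((4 * M * (lam * f))⁻¹ * s + (4 * M * (lam * f))⁻¹ ^ 2 * (2 * (lam * f) * s))
      = L * (z ^ 2 / 4) * s * (1 / (M * lam ^ 2)) +
        L * (z ^ 2 / 4) * s * (1 / (M * lam ^ 2)) * (1 / (2 * M)) := by
    rw [hx]; field_simp; ring
  have h3 : (4 * M * (lam * f))⁻¹ * (lam ^ 2 * (16 * M * (2 * s + 44)) * L * x / 2 / 2)
      = lam * L * (2 * s + 44) * z := by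
    rw [hx]; field_simp; ring
  have h4 : 1 / (M * lam ^ 2) ≤ 1 := by
    rw [div_le_one (by positivity)]
    nlinarith
  have h5 : 1 / (2 * M) ≤ 1 := by
    rw [div_le_one (by positivity)]
    linarith
  have h6 : L * (z ^ 2 / 4) * s * (1 / (M * lam ^ 2)) ≤ L * s := by
    have : z ^ 2 / 4 ≤ 1 := by nlinarith
    calc L * (z ^ 2 / 4) * s * (1 / (M * lam ^ 2)) ≤ L * 1 * s * 1 := by gcongr
      _ = L * s := by ring
  have h7 : L * (z ^ 2 / 4) * s * (1 / (M * lam ^ 2)) * (1 / (2 * M)) ≤ L * s :=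
    (mul_le_of_le_one_right (by positivity) h5).trans h6
  have h8 : lam * L * (2 * s + 44) ≤ lam * L * (2 * s + 44) * z :=
    le_mul_of_one_le_right (by positivity) hz1
  have h9 : L * s ≤ lam * (L * s) := le_mul_of_one_le_left (by positivity) hlam
  have h10 : 0 < lam * L := by positivity
  rw [h3]
  rw [h2] at h1
  nlinarith

/-- Here `y = √w`, and means are tested at level `lam α y`. The variance term is half the main term,
leaving `lam L z α² / (64 M) ≥ 5 lam L`, where `z = x / f`. This is the origin of `320`; the bias
costs at most one further `L`. -/
theorem coord_exponent_le {M lam L x y f N s α : ℝ} (hM : 1 ≤ M) (hlam : 1 ≤ lam) (hL : 0 < L)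
    (hf : 0 < f) (hfx : f ≤ x) (hxf : x ≤ 2 * f) (hN : N ≤ L * x ^ 2 / (lam * f)) (hs : 0 ≤ s)
    (hy : 0 < y) (hxy : x * y ^ 2 = 1) (hα : 0 < α) (hα2 : 320 * M ≤ α ^ 2)
    (hsy : s * α * y ≤ 1) :
    -((α * y / (16 * M * f)) * (L * x ^ 2 * (lam * α * y) / 2)) +
      N * ((α * y / (16 * M * f)) * s + (α * y / (16 * M * f)) ^ 2 * (4 * (lam * f) ^ 2 * M)) ≤
      -(4 * lam * L) := by
  set z := x / f with hz
  have hz1 : 1 ≤ z := (one_le_div hf).2 hfx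
  have hz2 : z ≤ 2 := (div_le_iff₀ hf).2 hxf
  have hx : x = z * f := by rw [hz]; field_simp
  have hc : 0 ≤ (α * y / (16 * M * f)) * s +
      (α * y / (16 * M * f)) ^ 2 * (4 * (lam * f) ^ 2 * M) := by positivity
  have h1 := mul_le_mul_of_nonneg_right hN hc
  have h2 : L * x ^ 2 / (lam * f) * ((α * y / (16 * M * f)) * s +
      (α * y / (16 * M * f)) ^ 2 * (4 * (lam * f) ^ 2 * M))
      = L * (z ^ 2 / 4) * (s * α * y) * (1 / (4 * M * lam)) +
        lam * L * (z * (α ^ 2 / M)) / 64 * (x * y ^ 2) := by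
    rw [hx]; field_simp; ring
  have h3 : (α * y / (16 * M * f)) * (L * x ^ 2 * (lam * α * y) / 2)
      = lam * L * (z * (α ^ 2 / M)) / 32 * (x * y ^ 2) := by
    rw [hx]; field_simp; ring
  have h4 : 1 / (4 * M * lam) ≤ 1 := by
    rw [div_le_one (by positivity)]
    nlinarith
  have h6 : L * (z ^ 2 / 4) * (s * α * y) * (1 / (4 * M * lam)) ≤ L := by
    have : z ^ 2 / 4 ≤ 1 := by nlinarith
    calc L * (z ^ 2 / 4) * (s * α * y) * (1 / (4 * M * lam)) ≤ L * 1 * 1 * 1 := by gcongr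
      _ = L := by ring
  have h7 : 320 ≤ α ^ 2 / M := (le_div_iff₀ (by positivity)).2 hα2
  have h8 : 320 ≤ z * (α ^ 2 / M) := by nlinarith
  have h9 : L ≤ lam * L := le_mul_of_one_le_left hL.le hlam
  have h10 : lam * L * 320 ≤ lam * L * (z * (α ^ 2 / M)) := by gcongr
  rw [h3, hxy]
  rw [h2, hxy] at h1
  linarith

theorem sampleCov_eq {J T : ℕ} (hT : 0 < T) (x : Fin T → Fin J → ℝ) (i j : Fin J) :
    sampleCov x i j = (T : ℝ)⁻¹ * ∑ t, x t i * x t j - sampleMean x i * sampleMean x j := by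
  have hT' : (T : ℝ) ≠ 0 := by positivity
  have h : ∀ i, ∑ t, x t i = T * sampleMean x i := fun i => by
    unfold sampleMean; field_simp
  have h2 : ∑ t, (x t i - sampleMean x i) * (x t j - sampleMean x j)
      = ∑ t, x t i * x t j - T * (sampleMean x i * sampleMean x j) := by
    simp_rw [sub_mul, mul_sub, Finset.sum_sub_distrib, ← Finset.sum_mul, ← Finset.mul_sum, h]
    simp
    ring
  unfold sampleCov
  rw [Matrix.of_apply, h2, mul_sub, ← mul_assoc _ (T : ℝ), inv_mul_cancel₀ hT', one_mul]

/-- The exponential equals `J ^ (-4 lam)`. Since `J ^ lam ≥ lam` and `4 lam ≥ lam + 3`, it beats the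
`J²` events and leaves both factors of the denominator, which allows smallness through large `J` or
through large `lam`. -/
theorem union_bound_le {J lam : ℕ} (hJ : 2 ≤ J) (hlam : 1 ≤ lam) {δ C : ℝ} (hC : 0 ≤ C) :
    (J : ℝ) ^ 2 * (4 * (Real.exp (-(4 * lam * Real.log J)) +
        2 * C / (lam * (J : ℝ) ^ (2 + δ)))) +
      J * (4 * (Real.exp (-(4 * lam * Real.log J)) + 2 * C / (lam * (J : ℝ) ^ (2 + δ)))) ≤
      (8 + 16 * C) / (lam * (J : ℝ) ^ min δ 1) := by
  have hJ' : (2 : ℝ) ≤ J := by exact_mod_cast hJ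
  have hlam' : (1 : ℝ) ≤ lam := by exact_mod_cast hlam
  set L := Real.log J with hL
  set p : ℝ := 4 * (Real.exp (-(4 * lam * L)) + 2 * C / (lam * (J : ℝ) ^ (2 + δ))) with hp
  have hp0 : 0 ≤ p := by positivity
  have hJ0 : (0 : ℝ) < J := by linarith
  have hJp : J ^ 2 * p + J * p ≤ 2 * (J ^ 2 * p) := by
    have : (J : ℝ) * p ≤ J ^ 2 * p := by
      gcongr
      nlinarith
    linarith
  have hexp : (J : ℝ) ^ 2 * Real.exp (-(4 * lam * L)) ≤ 1 / (lam * (J : ℝ) ^ min δ 1) := by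
    have h1 : Real.exp (-(4 * lam * L)) = ((J : ℝ) ^ (4 * lam))⁻¹ := by
      rw [Real.exp_neg, show 4 * (lam : ℝ) * L = ((4 * lam : ℕ) : ℝ) * L by push_cast; ring,
        Real.exp_nat_mul, hL, Real.exp_log hJ0]
    have h2 : (lam : ℝ) ≤ J ^ lam := by
      have : lam < 2 ^ lam := Nat.lt_two_pow_self
      have h3 : (lam : ℝ) ≤ 2 ^ lam := by exact_mod_cast this.le
      exact h3.trans (pow_le_pow_left₀ (by norm_num) hJ' _)
    have h3 : (J : ℝ) ^ min δ 1 ≤ J := by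
      calc (J : ℝ) ^ min δ 1 ≤ J ^ (1 : ℝ) :=
            Real.rpow_le_rpow_of_exponent_le (by linarith) (min_le_right _ _)
        _ = J := Real.rpow_one _
    have h4 : (J : ℝ) ^ 2 * (J ^ lam * J) ≤ J ^ (4 * lam) := by
      rw [← pow_succ, ← pow_add]
      exact pow_le_pow_right₀ (by linarith) (by omega)
    rw [h1, ← div_eq_mul_inv, div_le_div_iff₀ (by positivity) (by positivity), one_mul]
    refine le_trans ?_ h4
    gcongr
  have hmix : (J : ℝ) ^ 2 * (2 * C / (lam * (J : ℝ) ^ (2 + δ))) ≤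
      2 * C / (lam * (J : ℝ) ^ min δ 1) := by
    rw [Real.rpow_add hJ0, Real.rpow_two]
    calc _ = 2 * C / (lam * (J : ℝ) ^ δ) := by field_simp
      _ ≤ _ := by
        gcongr
        · linarith
        · exact min_le_left _ _
  calc J ^ 2 * p + J * p ≤ 2 * (J ^ 2 * p) := hJp
    _ = 8 * ((J : ℝ) ^ 2 * Real.exp (-(4 * lam * L)) +
        (J : ℝ) ^ 2 * (2 * C / (lam * (J : ℝ) ^ (2 + δ)))) := by rw [hp]; ring
    _ ≤ 8 * (1 / (lam * (J : ℝ) ^ min δ 1) + 2 * C / (lam * (J : ℝ) ^ min δ 1)) := by gcongr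
    _ = _ := by ring

/-! ### Uniform deviation of the sample covariance matrix -/

namespace Admissible

variable {Ω : Type*} [MeasurableSpace Ω] {P : Measure Ω} [IsProbabilityMeasure P] {J T : ℕ}
  {X : Fin T → Fin J → Ω → ℝ} {S : Matrix (Fin J) (Fin J) ℝ} {σ M ρ : ℝ} {k : ℕ} {b : ℝ}

/-- Uniform deviation bound for the sample covariance matrix, with `w = √(log J / T)`. The scale
parameter `lam` lengthens the blocks, which makes the bound small even when `J` is bounded. -/
theorem measureReal_deviation_le (h : Admissible P X S σ M ρ k b) {M₁ : ℝ} (hM : M ≤ M₁)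
    (hM₁ : 1 ≤ M₁) (hS : ∀ i, S i i ≤ M₁) (hJ : 2 ≤ J) (hT : 1 ≤ T) {w A : ℝ}
    (hw : w = √(Real.log J / T)) (hA : A = 16 * M₁ * (2 * σ ^ 2 + 44)) {lam : ℕ} (hlam : 1 ≤ lam)
    (hw1 : 2 * lam * w ≤ 1) (hw2 : lam * √(A / 2) * √w ≤ 1) (hw3 : σ ^ 2 * √(A / 2) * √w ≤ 1)
    (hk : (k : ℝ) ≤ √(T / Real.log J)) {δ C : ℝ} (hC : 0 ≤ C)
    (hb : b ≤ C * ((J : ℝ) ^ (2 + δ) * √(Real.log J * T))⁻¹) :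
    P.real {ω | (∀ t i j, |X t i ω * X t j ω| ≤ M) ∧
      ∃ i j, lam ^ 2 * A * w < |sampleCov (fun t i => X t i ω) i j - S i j|} ≤
      (8 + 16 * C) / (lam * (J : ℝ) ^ min δ 1) := by
  set L := Real.log J with hL
  have hJ' : (2 : ℝ) ≤ J := by exact_mod_cast hJ
  have hT' : (1 : ℝ) ≤ T := by exact_mod_cast hT
  have hlam' : (1 : ℝ) ≤ lam := by exact_mod_cast hlam
  -- Needed for `ℓ ≤ T`: one has `ℓ ≤ x² / 2` and `T = L x²`.
  have hLhalf : 1 / 2 ≤ L := by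
    have h1 := Real.log_two_gt_d9
    have h2 := Real.log_le_log (by norm_num) hJ'
    linarith
  have hL0 : 0 < L := by linarith
  have hw0 : 0 < w := by rw [hw]; positivity
  have hwsq : w ^ 2 = L / T := by rw [hw]; exact Real.sq_sqrt (by positivity)
  set x := w⁻¹ with hx
  have hx0 : 0 < x := by positivity
  have hTx : (T : ℝ) = L * x ^ 2 := by
    rw [hx, inv_pow, hwsq]; field_simp
  have hkx : (k : ℝ) ≤ x := by
    have : √(T / L) = x := by rw [hx, hw, ← Real.sqrt_inv, inv_div]
    rwa [← this]
  have hx2 : 2 * lam ≤ x := by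
    rw [hx, ← one_div, le_div_iff₀ hw0]; exact hw1
  set f := ⌊x⌋₊ with hf
  have hfx : (f : ℝ) ≤ x := Nat.floor_le hx0.le
  have hf2 : 2 ≤ f := Nat.le_floor (by push_cast; linarith)
  have hf2' : (2 : ℝ) ≤ f := by exact_mod_cast hf2
  have hf0 : (0 : ℝ) < f := by linarith
  have hxf : x ≤ 2 * f := by
    have := Nat.lt_floor_add_one x
    linarith
  have hkf : k ≤ f := Nat.le_floor hkx
  set ℓ := lam * f with hℓ
  have hℓ' : (ℓ : ℝ) = lam * f := by rw [hℓ]; push_cast; rfl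
  have hfℓ : f ≤ ℓ := Nat.le_mul_of_pos_left f hlam
  have hℓT : ℓ ≤ T := by
    have : (ℓ : ℝ) ≤ T := by
      rw [hℓ', hTx]
      have h1 : (lam : ℝ) * f ≤ (x / 2) * x := by gcongr; linarith
      nlinarith
    exact_mod_cast this
  set N := T / ℓ with hN
  have hNle : (N : ℝ) ≤ L * x ^ 2 / (lam * f) := by
    rw [← hTx, ← hℓ']; exact Nat.cast_div_le
  set D : ℝ := C * ((J : ℝ) ^ (2 + δ) * √(L * T))⁻¹ with hD
  have hD0 : 0 ≤ D := by positivity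
  have hsqrt : √(L * T) = L * x := by
    rw [hTx, show L * (L * x ^ 2) = (L * x) ^ 2 by ring]
    exact Real.sqrt_sq (by positivity)
  have hND : N * D ≤ 2 * C / (lam * (J : ℝ) ^ (2 + δ)) := by
    calc N * D ≤ L * x ^ 2 / (lam * f) * D := mul_le_mul_of_nonneg_right hNle hD0
      _ = (x / f) * (C / (lam * (J : ℝ) ^ (2 + δ))) := by
        rw [hD, hsqrt]; field_simp
      _ ≤ 2 * (C / (lam * (J : ℝ) ^ (2 + δ))) := by
        gcongr
        exact (div_le_iff₀ hf0).2 hxf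
      _ = _ := by ring
  have hA0 : 0 < A := by rw [hA]; positivity
  -- Chosen so that two sample means of size at most `lam α √w` have a product of size at most `lam²
  -- A w / 2`, half of the allowed deviation.
  set α := √(A / 2) with hα
  have hα0 : 0 < α := by rw [hα]; positivity
  have hαsq : α ^ 2 = A / 2 := Real.sq_sqrt (by positivity)
  have hα2 : 320 * M₁ ≤ α ^ 2 := by
    rw [hαsq, hA]
    nlinarith [mul_nonneg (by linarith : (0 : ℝ) ≤ M₁) (sq_nonneg σ)]
  set y := √w with hy
  have hy0 : 0 < y := by rw [hy]; positivity
  have hysq : y ^ 2 = w := Real.sq_sqrt hw0.le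
  have hxy : x * y ^ 2 = 1 := by rw [hysq, hx]; exact inv_mul_cancel₀ hw0.ne'
  set p : ℝ := 4 * (Real.exp (-(4 * lam * L)) + 2 * C / (lam * (J : ℝ) ^ (2 + δ))) with hp
  have hprod : ∀ i j, P.real {ω | (∀ t i j, |X t i ω * X t j ω| ≤ M) ∧
      lam ^ 2 * A * L * x / 2 ≤ |∑ t, (X t i ω * X t j ω - S i j)|} ≤ p := by
    intro i j
    have hM₁0 : 0 < M₁ := by linarith
    refine (h.measureReal_prod_tail hM hM₁ hS (hf2.trans hfℓ) hℓT (hkf.trans hfℓ) hD0 hb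
      (θ := (4 * M₁ * ℓ)⁻¹) (by positivity) (le_of_eq ?_) _ i j).trans ?_
    · have : (ℓ : ℝ) ≠ 0 := by rw [hℓ']; positivity
      field_simp
      norm_num
    · rw [hp, hA, hℓ']
      gcongr
      exact prod_exponent_le hM₁ hlam' hL0 hf0 hfx hxf hNle (sq_nonneg σ)
  have hcoord : ∀ i, P.real {ω | (∀ t i j, |X t i ω * X t j ω| ≤ M) ∧
      L * x ^ 2 * (lam * α * y) ≤ |∑ t, X t i ω|} ≤ p := by
    intro i
    have hM₁0 : 0 < M₁ := by linarith
    refine (h.measureReal_coord_tail hM hM₁ hS (hf2.trans hfℓ) hℓT (hkf.trans hfℓ) hD0 hb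
      (θ := α * y / (16 * M₁ * f)) (by positivity) ?_ _ i).trans ?_
    · rw [hℓ']
      have : α * y / (16 * M₁ * f) * (2 * M₁ * (2 * (lam * f))) = lam * α * y / 4 := by
        field_simp; norm_num
      rw [this]
      linarith
    · rw [hp, hℓ']
      gcongr
      exact coord_exponent_le hM₁ hlam' hL0 hf0 hfx hxf hNle (sq_nonneg σ) hy0 hxy hα0 hα2 hw3
  have hsub : {ω | (∀ t i j, |X t i ω * X t j ω| ≤ M) ∧
      ∃ i j, lam ^ 2 * A * w < |sampleCov (fun t i => X t i ω) i j - S i j|} ⊆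
      (⋃ ij : Fin J × Fin J, {ω | (∀ t i j, |X t i ω * X t j ω| ≤ M) ∧
        lam ^ 2 * A * L * x / 2 ≤ |∑ t, (X t ij.1 ω * X t ij.2 ω - S ij.1 ij.2)|}) ∪
      ⋃ i : Fin J, {ω | (∀ t i j, |X t i ω * X t j ω| ≤ M) ∧
        L * x ^ 2 * (lam * α * y) ≤ |∑ t, X t i ω|} := by
    rintro ω ⟨h1, i, j, h2⟩
    by_contra hcon
    simp only [Set.mem_union, Set.mem_iUnion, Set.mem_ofPred_eq, not_or, not_exists, not_and,
      not_le] at hcon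
    obtain ⟨h3, h4⟩ := hcon
    have h3 := h3 (i, j) h1
    have hT0 : (0 : ℝ) < T := by linarith
    have hmean : ∀ i, |sampleMean (fun t i => X t i ω) i| ≤ lam * α * y := by
      intro i
      have := (h4 i h1).le
      unfold sampleMean
      rw [abs_mul, abs_of_pos (inv_pos.2 hT0), inv_mul_le_iff₀ hT0, hTx]
      exact this
    have hmm : |sampleMean (fun t i => X t i ω) i * sampleMean (fun t i => X t i ω) j| ≤
        lam ^ 2 * A * w / 2 := by
      rw [abs_mul]
      calc _ ≤ (lam * α * y) * (lam * α * y) := by gcongr <;> exact hmean _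
        _ = lam ^ 2 * α ^ 2 * y ^ 2 := by ring
        _ = _ := by rw [hαsq, hysq]; ring
    have hav : |(T : ℝ)⁻¹ * ∑ t, X t i ω * X t j ω - S i j| ≤ lam ^ 2 * A * w / 2 := by
      have h5 : (T : ℝ)⁻¹ * ∑ t, X t i ω * X t j ω - S i j
          = (T : ℝ)⁻¹ * ∑ t, (X t i ω * X t j ω - S i j) := by
        rw [Finset.sum_sub_distrib]
        simp only [Finset.sum_const, Finset.card_univ, Fintype.card_fin, nsmul_eq_mul]
        field_simp
      rw [h5, abs_mul, abs_of_pos (inv_pos.2 hT0), inv_mul_le_iff₀ hT0, hTx]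
      refine h3.le.trans (le_of_eq ?_)
      rw [hx]; field_simp
    rw [sampleCov_eq (by omega)] at h2
    have h6 : (T : ℝ)⁻¹ * ∑ t, X t i ω * X t j ω -
        sampleMean (fun t i => X t i ω) i * sampleMean (fun t i => X t i ω) j - S i j =
        ((T : ℝ)⁻¹ * ∑ t, X t i ω * X t j ω - S i j) -
        sampleMean (fun t i => X t i ω) i * sampleMean (fun t i => X t i ω) j := by ring
    rw [h6] at h2
    have := abs_sub ((T : ℝ)⁻¹ * ∑ t, X t i ω * X t j ω - S i j)
      (sampleMean (fun t i => X t i ω) i * sampleMean (fun t i => X t i ω) j)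
    linarith
  have htotal : P.real {ω | (∀ t i j, |X t i ω * X t j ω| ≤ M) ∧
      ∃ i j, lam ^ 2 * A * w < |sampleCov (fun t i => X t i ω) i j - S i j|} ≤
      J ^ 2 * p + J * p := by
    refine (measureReal_mono hsub).trans ((measureReal_union_le _ _).trans (add_le_add ?_ ?_))
    · refine (measureReal_iUnion_fintype_le _).trans
        ((Finset.sum_le_sum fun ij _ => hprod ij.1 ij.2).trans (le_of_eq ?_))
      simp [sq]
    · refine (measureReal_iUnion_fintype_le _).trans
        ((Finset.sum_le_sum fun i _ => hcoord i).trans (le_of_eq ?_))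
      simp
  exact htotal.trans (union_bound_le hJ hlam hC)

end Admissible

/-! ### Deterministic bounds for thresholding -/

/-- Schur test for a symmetric matrix. -/
theorem opNorm_le_of_row_sum_le {J : ℕ} {A : Matrix (Fin J) (Fin J) ℝ} (hA : ∀ i j, A i j = A j i)
    {R : ℝ} (hR : 0 ≤ R) (h : ∀ i, ∑ j, |A i j| ≤ R) : opNorm A ≤ R := by
  refine ContinuousLinearMap.opNorm_le_bound _ hR fun v => ?_
  refine le_of_sq_le_sq ?_ (by positivity)
  rw [mul_pow, EuclideanSpace.norm_sq_eq, EuclideanSpace.norm_sq_eq]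
  simp_rw [Real.norm_eq_abs, sq_abs]
  have hrow : ∀ i, (Matrix.toEuclideanCLM (n := Fin J) (𝕜 := ℝ) A v).ofLp i ^ 2 ≤
      R * ∑ j, |A i j| * v.ofLp j ^ 2 := by
    intro i
    have h1 : (Matrix.toEuclideanCLM (n := Fin J) (𝕜 := ℝ) A v).ofLp i
        = ∑ j, A i j * v.ofLp j := by
      rw [Matrix.ofLp_toEuclideanCLM]; rfl
    rw [h1]
    have h2 : (∑ j, A i j * v.ofLp j) ^ 2 ≤ (∑ j, |A i j|) * ∑ j, |A i j| * v.ofLp j ^ 2 := by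
      refine Finset.sum_sq_le_sum_mul_sum_of_sq_le_mul _ (fun j _ => abs_nonneg _)
        (fun j _ => by positivity) fun j _ => le_of_eq ?_
      rw [mul_pow, ← sq_abs (A i j)]; ring
    exact h2.trans (mul_le_mul_of_nonneg_right (h i)
      (Finset.sum_nonneg fun j _ => by positivity))
  calc _ ≤ ∑ i, R * ∑ j, |A i j| * v.ofLp j ^ 2 := Finset.sum_le_sum fun i _ => hrow i
    _ = R * ∑ j, (∑ i, |A j i|) * v.ofLp j ^ 2 := by
        rw [← Finset.mul_sum, Finset.sum_comm]
        simp_rw [Finset.sum_mul, fun i j => hA i j]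
    _ ≤ R * ∑ j, R * v.ofLp j ^ 2 := by
        gcongr with j
        exact h j
    _ = _ := by rw [← Finset.mul_sum]; ring

theorem inv_mul_frobSq_le {J : ℕ} (hJ : 0 < J) {A : Matrix (Fin J) (Fin J) ℝ} {R m : ℝ}
    (h : ∀ i, ∑ j, |A i j| ≤ R) (hm : 0 ≤ m) (hA : ∀ i j, |A i j| ≤ m) :
    (J : ℝ)⁻¹ * frobSq A ≤ R * m := by
  have hJ' : (0 : ℝ) < J := by exact_mod_cast hJ
  rw [inv_mul_le_iff₀ hJ']
  calc frobSq A ≤ ∑ _i : Fin J, R * m := by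
        refine Finset.sum_le_sum fun i _ => ?_
        calc ∑ j, A i j ^ 2 ≤ ∑ j, |A i j| * m := Finset.sum_le_sum fun j _ => by
              rw [← sq_abs, sq]
              exact mul_le_mul_of_nonneg_left (hA i j) (abs_nonneg _)
          _ ≤ R * m := by
              rw [← Finset.sum_mul]
              exact mul_le_mul_of_nonneg_right (h i) hm
    _ = _ := by simp

theorem nonneg_of_mem_uniformityClass {J : ℕ} (hJ : 0 < J) {q c M : ℝ}
    {S : Matrix (Fin J) (Fin J) ℝ} (hS : S ∈ uniformityClass q c M) : 0 ≤ c :=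
  le_trans (Finset.sum_nonneg fun j _ => by split_ifs <;> positivity) (hS.2.2 ⟨0, hJ⟩)

/-- Interpolation: `|E| = |E|^q |E|^{1-q} ≤ |S|^q τ^{1-q}` entrywise, so the class bounds the row
sums. Entries with `S i j = 0` carry no error, which covers the convention for `q = 0`. -/
theorem errors_le_of_abs_le_abs {J : ℕ} (hJ : 0 < J) {q c M τ : ℝ} (hq : 0 ≤ q) (hq1 : q < 1)
    (hτ : 0 < τ) {S E : Matrix (Fin J) (Fin J) ℝ} (hS : S ∈ uniformityClass q c M)
    (hE : ∀ i j, E i j = E j i) (h1 : ∀ i j, |E i j| ≤ |S i j|) (h2 : ∀ i j, |E i j| ≤ τ) :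
    opNorm E ≤ c * τ ^ (1 - q) ∧ (J : ℝ)⁻¹ * frobSq E ≤ c * τ ^ (1 - q) * τ := by
  have hc := nonneg_of_mem_uniformityClass hJ hS
  have hrow : ∀ i, ∑ j, |E i j| ≤ c * τ ^ (1 - q) := by
    intro i
    refine le_trans ?_ (mul_le_mul_of_nonneg_right (hS.2.2 i) (by positivity))
    rw [Finset.sum_mul]
    refine Finset.sum_le_sum fun j _ => ?_
    split_ifs with h0
    · have := h1 i j
      rw [h0, abs_zero] at this
      simpa using this
    · rcases (abs_nonneg (E i j)).eq_or_lt with h | h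
      · rw [← h]; positivity
      · calc |E i j| = |E i j| ^ q * |E i j| ^ (1 - q) := by
              rw [← Real.rpow_add h]; simp
          _ ≤ |S i j| ^ q * τ ^ (1 - q) := by
              exact mul_le_mul (Real.rpow_le_rpow h.le (h1 i j) hq)
                (Real.rpow_le_rpow h.le (h2 i j) (by linarith)) (by positivity) (by positivity)
  exact ⟨opNorm_le_of_row_sum_le hE (by positivity) hrow, inv_mul_frobSq_le hJ hrow hτ.le h2⟩

theorem errors_le_of_abs_le {J : ℕ} (hJ : 0 < J) {m : ℝ} (hm : 0 ≤ m)
    {E : Matrix (Fin J) (Fin J) ℝ} (hE : ∀ i j, E i j = E j i) (h : ∀ i j, |E i j| ≤ m) :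
    opNorm E ≤ J * m ∧ (J : ℝ)⁻¹ * frobSq E ≤ J * m * m := by
  have hrow : ∀ i, ∑ j, |E i j| ≤ J * m := fun i =>
    (Finset.sum_le_sum fun j _ => h i j).trans (le_of_eq (by simp))
  exact ⟨opNorm_le_of_row_sum_le hE (by positivity) hrow, inv_mul_frobSq_le hJ hrow hm h⟩

theorem threshold_sub_symm {J T : ℕ} (s : ℝ) (x : Fin T → Fin J → ℝ)
    {S : Matrix (Fin J) (Fin J) ℝ} (hS : S.PosSemidef) (i j : Fin J) :
    (threshold s (sampleCov x) - S) i j = (threshold s (sampleCov x) - S) j i := by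
  have h1 : sampleCov x i j = sampleCov x j i := by
    simp only [sampleCov, Matrix.of_apply, mul_comm]
  have h2 : S i j = S j i := by
    simpa using hS.isHermitian.apply j i
  simp only [Matrix.sub_apply, threshold, Matrix.of_apply, h1, h2]

theorem abs_threshold_sub_le {J : ℕ} {s : ℝ} (A S : Matrix (Fin J) (Fin J) ℝ) (i j : Fin J)
    {d : ℝ} (h : |A i j - S i j| ≤ d) :
    |(threshold s A - S) i j| ≤ d + s ∨ |(threshold s A - S) i j| ≤ d := by
  simp only [Matrix.sub_apply, threshold, Matrix.of_apply]
  split_ifs with h1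
  · exact Or.inr h
  · left
    rw [zero_sub, abs_neg]
    have := abs_sub_abs_le_abs_sub (S i j) (A i j)
    rw [abs_sub_comm] at this
    linarith

/-- A kept entry has `|A i j| ≥ s`, hence `|S i j| ≥ s / 2`, which dominates its error; a discarded
entry has error exactly `|S i j|`. -/
theorem abs_threshold_sub_le_of_half {J : ℕ} {s : ℝ} (hs : 0 ≤ s)
    (A S : Matrix (Fin J) (Fin J) ℝ) (i j : Fin J) (h : |A i j - S i j| ≤ s / 2) :
    |(threshold s A - S) i j| ≤ |S i j| ∧ |(threshold s A - S) i j| ≤ 3 / 2 * s := by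
  refine ⟨?_, by rcases abs_threshold_sub_le (s := s) A S i j h with h | h <;> linarith⟩
  simp only [Matrix.sub_apply, threshold, Matrix.of_apply]
  split_ifs with h1
  · have := abs_sub_abs_le_abs_sub (A i j) (S i j)
    linarith
  · simp

theorem abs_threshold_sub_of_lt {J : ℕ} {s : ℝ} (A S : Matrix (Fin J) (Fin J) ℝ) (i j : Fin J)
    (h : |A i j| < s) : |(threshold s A - S) i j| = |S i j| := by
  simp [Matrix.sub_apply, threshold, Matrix.of_apply, not_le.2 h]

theorem sampleCov_self_le {J T : ℕ} (hT : 0 < T) (x : Fin T → Fin J → ℝ) (i : Fin J) :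
    sampleCov x i i ≤ (T : ℝ)⁻¹ * ∑ t, x t i ^ 2 := by
  rw [sampleCov_eq hT]
  simp_rw [← sq]
  linarith [sq_nonneg (sampleMean x i)]

theorem abs_sampleCov_le {J T : ℕ} (x : Fin T → Fin J → ℝ) (i j : Fin J) :
    |sampleCov x i j| ≤ (sampleCov x i i + sampleCov x j j) / 2 := by
  simp only [sampleCov, Matrix.of_apply]
  rw [abs_mul, abs_of_nonneg (by positivity), ← mul_add, mul_div_assoc, ← Finset.sum_add_distrib,
    Finset.sum_div]
  refine mul_le_mul_of_nonneg_left ((Finset.abs_sum_le_sum_abs _ _).trans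
    (Finset.sum_le_sum fun t _ => ?_)) (by positivity)
  rw [abs_le]
  constructor <;>
  nlinarith [sq_nonneg (x t i - sampleMean x i + (x t j - sampleMean x j)),
    sq_nonneg (x t i - sampleMean x i - (x t j - sampleMean x j))]

/-- Error bounds for a thresholded sample covariance matrix with entrywise errors at most `|S i j|`. -/
theorem errors_le_of_abs_threshold_sub_le {J T : ℕ} (hJ : 0 < J) {q c M M' w : ℝ} (hq : 0 ≤ q) (hq1 : q < 1)
    (hM' : 0 < M') (hw : 0 < w) {S : Matrix (Fin J) (Fin J) ℝ} (hS : S ∈ uniformityClass q c M)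
    {x : Fin T → Fin J → ℝ}
    (hx : ∀ i j, |(threshold (M' * w) (sampleCov x) - S) i j| ≤ |S i j|)
    (hx' : ∀ i j, |(threshold (M' * w) (sampleCov x) - S) i j| ≤ 3 / 2 * (M' * w)) :
    opNorm (threshold (M' * w) (sampleCov x) - S) ≤
        (3 / 2 * M') ^ (1 - q) * (c * w ^ (1 - q)) ∧
      (J : ℝ)⁻¹ * frobSq (threshold (M' * w) (sampleCov x) - S) ≤
        (3 / 2 * M') ^ (1 - q) * (3 / 2 * M') * (c * (w ^ (1 - q) * w)) := by
  have h := errors_le_of_abs_le_abs hJ hq hq1 (τ := 3 / 2 * (M' * w)) (by positivity) hS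
    (threshold_sub_symm (M' * w) x hS.1) hx hx'
  have hpow : (3 / 2 * (M' * w)) ^ (1 - q) = (3 / 2 * M') ^ (1 - q) * w ^ (1 - q) := by
    rw [← mul_assoc, Real.mul_rpow (by positivity) hw.le]
  rw [hpow] at h
  refine ⟨h.1.trans (le_of_eq (by ring)), h.2.trans (le_of_eq (by ring))⟩

/-! ### Exceptional events and the case of bounded dimension -/

namespace Admissible

variable {Ω : Type*} [MeasurableSpace Ω] {P : Measure Ω} [IsProbabilityMeasure P] {J T : ℕ}
  {X : Fin T → Fin J → Ω → ℝ} {S : Matrix (Fin J) (Fin J) ℝ} {σ M ρ : ℝ} {k : ℕ} {b : ℝ}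

/-- Markov's inequality for the uncentred sample variances. -/
theorem measureReal_exists_sampleVar_ge_le (h : Admissible P X S σ M ρ k b) (hT : 0 < T)
    {s d : ℝ} (hs : 0 < s) (hS : ∀ i, S i i ≤ d) :
    P.real {ω | ∃ i, s ≤ (T : ℝ)⁻¹ * ∑ t, X t i ω ^ 2} ≤ J * (d / s) := by
  have hT' : (0 : ℝ) < T := by exact_mod_cast hT
  have hi : ∀ t i, Integrable (fun ω => X t i ω ^ 2) P := fun t i => (h.memLp_two t i).integrable_sq
  have hone : ∀ i, P.real {ω | s ≤ (T : ℝ)⁻¹ * ∑ t, X t i ω ^ 2} ≤ d / s := by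
    intro i
    have hmk := mul_meas_ge_le_integral_of_nonneg (μ := P)
      (f := fun ω => (T : ℝ)⁻¹ * ∑ t, X t i ω ^ 2) (ae_of_all _ fun ω => by positivity)
      ((integrable_finsetSum _ fun t _ => hi t i).const_mul _) s
    rw [integral_const_mul, integral_finsetSum _ fun t _ => hi t i] at hmk
    simp only [h.integral_sq, Finset.sum_const, Finset.card_univ, Fintype.card_fin,
      nsmul_eq_mul] at hmk
    rw [inv_mul_cancel_left₀ hT'.ne'] at hmk
    rw [le_div_iff₀ hs, mul_comm]
    exact hmk.trans (hS i)
  have hset : {ω | ∃ i, s ≤ (T : ℝ)⁻¹ * ∑ t, X t i ω ^ 2}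
      = ⋃ i, {ω | s ≤ (T : ℝ)⁻¹ * ∑ t, X t i ω ^ 2} := by
    ext ω; simp
  rw [hset]
  exact (measureReal_iUnion_fintype_le _).trans
    ((Finset.sum_le_sum fun i _ => hone i).trans (le_of_eq (by simp)))

/-- Off an event of small probability, the sample covariance matrix is uniformly close to the
covariance matrix. -/
theorem exists_deviation_set (h : Admissible P X S σ M ρ k b) {d η η' : ℝ} (hη : ρ ≤ η)
    (hη0 : 0 ≤ η) (hη0' : 0 ≤ η')
    (hd : P.real {ω | (∀ t i j, |X t i ω * X t j ω| ≤ M) ∧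
      ∃ i j, d < |sampleCov (fun t i => X t i ω) i j - S i j|} ≤ η') :
    ∃ B : Set Ω, P B ≤ ENNReal.ofReal (η + η') ∧
      ∀ ω ∉ B, ∀ i j, |sampleCov (fun t i => X t i ω) i j - S i j| ≤ d := by
  refine ⟨{ω | ∃ t i j, M < |X t i ω * X t j ω|} ∪
    {ω | (∀ t i j, |X t i ω * X t j ω| ≤ M) ∧
      ∃ i j, d < |sampleCov (fun t i => X t i ω) i j - S i j|}, ?_, ?_⟩
  · rw [ENNReal.ofReal_add hη0 hη0']
    refine (measure_union_le _ _).trans (add_le_add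
      (h.bounded.trans (ENNReal.ofReal_le_ofReal hη)) ?_)
    rw [← ofReal_measureReal]
    exact ENNReal.ofReal_le_ofReal hd
  · intro ω hω i j
    simp only [Set.mem_union, Set.mem_ofPred_eq, not_or, not_exists, not_and, not_lt] at hω
    exact hω.2 hω.1 i j

/-- Error bounds in bounded dimension `J ≤ J₀`: a matrix `S` whose rows are not negligible absorbs
any error of order `w`, and a negligible one is thresholded to zero with high probability. -/
theorem exists_error_set_of_le (h : Admissible P X S σ M ρ k b) (hJ : 0 < J) (hT : 0 < T)
    {J₀ : ℕ} (hJ₀ : J ≤ J₀) {q c M' w a d η : ℝ} (hq : 0 ≤ q) (hq1 : q < 1) (hM' : 0 < M')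
    (hw : 0 < w) (ha : 0 < a) (haM : a ≤ M') (hd : 0 ≤ d) (hη : J₀ * a / M' ≤ η)
    (hS : S ∈ uniformityClass q c M) {B : Set Ω} (hB : P B ≤ ENNReal.ofReal η)
    (hBd : ∀ ω ∉ B, ∀ i j, |sampleCov (fun t i => X t i ω) i j - S i j| ≤ d * w) :
    ∃ B' : Set Ω, P B' ≤ ENNReal.ofReal η ∧ ∀ ω ∉ B',
      opNorm (threshold (M' * w) (sampleCov fun t i => X t i ω) - S) ≤
        ((3 / 2 * M') ^ (1 - q) + J₀ * (d + M') / a ^ q) * (c * w ^ (1 - q)) ∧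
      (J : ℝ)⁻¹ * frobSq (threshold (M' * w) (sampleCov fun t i => X t i ω) - S) ≤
        ((3 / 2 * M') ^ (1 - q) * (3 / 2 * M') + J₀ * (d + M') ^ 2 / a ^ q) *
          (c * (w ^ (1 - q) * w)) := by
  have hc := nonneg_of_mem_uniformityClass hJ hS
  have hJ₀' : (J : ℝ) ≤ J₀ := by exact_mod_cast hJ₀
  have hwq : w ^ q * w ^ (1 - q) = w := by rw [← Real.rpow_add hw]; simp
  -- If `c` is at least `(a w)^q`, the rate `c w^{1-q}` is at least `a^q w`, so an error of order
  -- `w` in each of at most `J₀` columns is harmless.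
  by_cases hca : (a * w) ^ q ≤ c
  · have haw : a ^ q * w ≤ c * w ^ (1 - q) := by
      calc a ^ q * w = (a * w) ^ q * w ^ (1 - q) := by
            rw [Real.mul_rpow ha.le hw.le, mul_assoc, hwq]
        _ ≤ _ := by gcongr
    refine ⟨B, hB, fun ω hω => ?_⟩
    have hE : ∀ i j, |(threshold (M' * w) (sampleCov fun t i => X t i ω) - S) i j| ≤
        (d + M') * w := fun i j => by
      have : 0 < M' * w := by positivity
      rcases abs_threshold_sub_le (s := M' * w) _ S i j (hBd ω hω i j) with h | h <;> linarith
    have herr := errors_le_of_abs_le hJ (by positivity)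
      (threshold_sub_symm (M' * w) (fun t i => X t i ω) hS.1) hE
    have hcw : 0 ≤ c * w ^ (1 - q) := by positivity
    constructor
    · refine herr.1.trans ?_
      rw [add_mul]
      have h1 : (J : ℝ) * ((d + M') * w) ≤ J₀ * (d + M') / a ^ q * (a ^ q * w) := by
        calc (J : ℝ) * ((d + M') * w) ≤ J₀ * ((d + M') * w) := by gcongr
          _ = _ := by field_simp
      have h2 : J₀ * (d + M') / a ^ q * (a ^ q * w) ≤
          J₀ * (d + M') / a ^ q * (c * w ^ (1 - q)) := by gcongr
      have h3 : 0 ≤ (3 / 2 * M') ^ (1 - q) * (c * w ^ (1 - q)) := by positivity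
      linarith
    · refine herr.2.trans ?_
      rw [add_mul]
      have h1 : (J : ℝ) * ((d + M') * w) * ((d + M') * w) ≤
          J₀ * (d + M') ^ 2 / a ^ q * ((a ^ q * w) * w) := by
        calc (J : ℝ) * ((d + M') * w) * ((d + M') * w)
            ≤ J₀ * ((d + M') * w) * ((d + M') * w) := by gcongr
          _ = _ := by field_simp
      have h2 : J₀ * (d + M') ^ 2 / a ^ q * ((a ^ q * w) * w) ≤
          J₀ * (d + M') ^ 2 / a ^ q * ((c * w ^ (1 - q)) * w) := by gcongr
      have h3 : 0 ≤ (3 / 2 * M') ^ (1 - q) * (3 / 2 * M') * (c * (w ^ (1 - q) * w)) := by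
        positivity
      rw [mul_assoc c] at h2
      linarith
  · push Not at hca
    -- A single larger entry would already exceed the row budget `c`. All variances are thus at most
    -- `a w`, and Markov's inequality keeps the sample variances, hence all entries, below the level
    -- `M' w`.
    have hSa : ∀ i j, |S i j| ≤ a * w := by
      intro i j
      by_contra! hlt
      have hne : S i j ≠ 0 := fun h0 => by
        rw [h0, abs_zero] at hlt
        linarith [mul_pos ha hw]
      have h1 : |S i j| ^ q ≤ c := by
        refine le_trans ?_ (hS.2.2 i)
        have := Finset.single_le_sum (f := fun j => if S i j = 0 then 0 else |S i j| ^ q)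
          (fun j _ => by split_ifs <;> positivity) (Finset.mem_univ j)
        simp only [if_neg hne] at this
        convert this
      have h2 : (a * w) ^ q ≤ |S i j| ^ q := Real.rpow_le_rpow (by positivity) hlt.le hq
      linarith
    have hs : 0 < M' * w := by positivity
    refine ⟨{ω | ∃ i, M' * w ≤ (T : ℝ)⁻¹ * ∑ t, X t i ω ^ 2}, ?_, fun ω hω => ?_⟩
    · rw [← ofReal_measureReal]
      refine ENNReal.ofReal_le_ofReal ((h.measureReal_exists_sampleVar_ge_le hT hs
        fun i => (le_abs_self _).trans (hSa i i)).trans (le_trans ?_ hη))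
      rw [mul_div_mul_right _ _ hw.ne', mul_div_assoc]
      gcongr
    · simp only [Set.mem_ofPred_eq, not_exists, not_le] at hω
      have hlt : ∀ i j, |sampleCov (fun t i => X t i ω) i j| < M' * w := fun i j => by
        have h1 := abs_sampleCov_le (fun t i => X t i ω) i j
        have h2 := fun i => (sampleCov_self_le hT (fun t i => X t i ω) i).trans_lt (hω i)
        linarith [h2 i, h2 j]
      have heq := fun i j => abs_threshold_sub_of_lt _ S i j (hlt i j)
      have herr := errors_le_of_abs_threshold_sub_le (x := fun t i => X t i ω) hJ hq hq1 hM' hw hS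
        (fun i j => (heq i j).le) (fun i j => by
          rw [heq i j]
          have : a * w ≤ M' * w := by gcongr
          linarith [hSa i j])
      refine ⟨herr.1.trans ?_, herr.2.trans ?_⟩
      · rw [add_mul]
        exact le_add_of_nonneg_right (by positivity)
      · rw [add_mul]
        exact le_add_of_nonneg_right (by positivity)

end Admissible

end ThresholdCov

/-! ### Choice of constants and conclusion -/

open ThresholdCov in
theorem theorem2 (σ M : ℝ) :
    ∃ M₀ : ℝ, 0 < M₀ ∧ ∀ M' : ℝ, M₀ ≤ M' →
      ∀ (q δ' C : ℝ), 0 ≤ q → q < 1 → 0 < δ' →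
      ∀ (J T k : ℕ → ℕ) (c₀ : ℕ → ℝ) (ρ : ℕ → ℝ),
      (∀ n, 2 ≤ J n) → (∀ n, 1 ≤ T n) →
      Tendsto (fun n => Real.log (J n) / (T n : ℝ)) atTop (𝓝 0) →
      Tendsto ρ atTop (𝓝 0) →
      (∀ n, 1 ≤ k n) → (∀ᶠ n in atTop, (k n : ℝ) ≤ Real.sqrt ((T n : ℝ) / Real.log (J n))) →
      ∀ ε : ℝ, 0 < ε → ∃ K : ℝ, 0 < K ∧ ∀ᶠ n in atTop,
        ∀ (Ω : Type*) [MeasurableSpace Ω] (P : Measure Ω) [IsProbabilityMeasure P]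
          (X : Fin (T n) → Fin (J n) → Ω → ℝ) (S : Matrix (Fin (J n)) (Fin (J n)) ℝ),
          S ∈ ThresholdCov.uniformityClass q (c₀ (J n)) M →
          ThresholdCov.Admissible P X S σ M (ρ n) (k n)
            (C * ((J n : ℝ) ^ (2 + δ') * Real.sqrt (Real.log (J n) * (T n : ℝ)))⁻¹) →
          P {ω | K * (c₀ (J n) * (Real.log (J n) / (T n : ℝ)) ^ ((1 - q) / 2)) <
              ThresholdCov.opNorm
                (ThresholdCov.threshold (M' * Real.sqrt (Real.log (J n) / (T n : ℝ)))
                  (ThresholdCov.sampleCov fun t i => X t i ω) - S)}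
            ≤ ENNReal.ofReal ε ∧
          P {ω | K * (c₀ (J n) * (Real.log (J n) / (T n : ℝ)) ^ (1 - q / 2)) <
              (J n : ℝ)⁻¹ * ThresholdCov.frobSq
                (ThresholdCov.threshold (M' * Real.sqrt (Real.log (J n) / (T n : ℝ)))
                  (ThresholdCov.sampleCov fun t i => X t i ω) - S)}
            ≤ ENNReal.ofReal ε := by
  set M₁ := max M 1 with hM₁def
  have hMM₁ : M ≤ M₁ := le_max_left _ _
  have hM₁ : 1 ≤ M₁ := le_max_right _ _
  set A := 16 * M₁ * (2 * σ ^ 2 + 44) with hA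
  have hA0 : 0 < A := by positivity
  -- With `lam = 1` the deviation is at most `A w`, half of the smallest admissible threshold.
  refine ⟨2 * A, by positivity, ?_⟩
  intro M' hM' q δ' C hq hq1 hδ J T k c₀ ρ hJ hT hr hρ _ hkT ε hε
  have hM'0 : 0 < M' := by linarith
  set C' := max C 0 with hC'
  have hC'0 : 0 ≤ C' := le_max_right _ _
  have hδ1 : 0 < min δ' 1 := lt_min hδ one_pos
  set D := 8 + 16 * C' with hD
  have hD0 : 0 < D := by positivity
  obtain ⟨J₀, hJ₀1, hJ₀⟩ : ∃ J₀ : ℕ, 1 ≤ J₀ ∧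
      ∀ j : ℕ, J₀ ≤ j → D / (((1 : ℕ) : ℝ) * (j : ℝ) ^ min δ' 1) ≤ ε / 2 := by
    have ht : Tendsto (fun j : ℕ => D / (((1 : ℕ) : ℝ) * (j : ℝ) ^ min δ' 1)) atTop (𝓝 0) := by
      simp only [Nat.cast_one, one_mul]
      exact ((tendsto_rpow_atTop hδ1).comp tendsto_natCast_atTop_atTop).const_div_atTop D
    obtain ⟨j₀, hj₀⟩ := eventually_atTop.1 (ht.eventually_le_const (half_pos hε))
    exact ⟨max j₀ 1, le_max_right _ _, fun j hj => hj₀ j ((le_max_left _ _).trans hj)⟩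
  obtain ⟨lam, hlam1, hlam⟩ : ∃ lam : ℕ, 1 ≤ lam ∧ D / (lam : ℝ) ≤ ε / 2 := by
    obtain ⟨m, hm⟩ := exists_nat_ge (D / (ε / 2))
    refine ⟨max m 1, le_max_right _ _, ?_⟩
    have h1 : (0 : ℝ) < (max m 1 : ℕ) := by positivity
    rw [div_le_iff₀ h1, mul_comm, ← div_le_iff₀ (by positivity)]
    exact hm.trans (by exact_mod_cast le_max_left m 1)
  have hJ₀0 : (0 : ℝ) < J₀ := by exact_mod_cast hJ₀1
  -- Small enough that the Markov bound `J₀ a / M'` is at most `ε`, while `a ≤ M'`.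
  set a := M' * (ε / (J₀ + ε)) with ha
  have ha0 : 0 < a := by positivity
  have haM : a ≤ M' := mul_le_of_le_one_right hM'0.le
    ((div_le_one (by positivity)).2 (by linarith))
  have haε : J₀ * a / M' ≤ ε := by
    have : J₀ * a / M' = ε * (J₀ / (J₀ + ε)) := by rw [ha]; field_simp
    rw [this]
    exact mul_le_of_le_one_right hε.le ((div_le_one (by positivity)).2 (by linarith))
  set d : ℝ := (lam : ℝ) ^ 2 * A with hd
  set K := ((3 / 2 * M') ^ (1 - q) + J₀ * (d + M') / a ^ q) +
    ((3 / 2 * M') ^ (1 - q) * (3 / 2 * M') + J₀ * (d + M') ^ 2 / a ^ q) with hK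
  have hK1 : 0 ≤ J₀ * (d + M') / a ^ q := by positivity
  have hK2 : 0 ≤ J₀ * (d + M') ^ 2 / a ^ q := by positivity
  have hK3 : 0 < (3 / 2 * M') ^ (1 - q) := by positivity
  have hK4 : 0 < (3 / 2 * M') ^ (1 - q) * (3 / 2 * M') := by positivity
  refine ⟨K, by linarith, ?_⟩
  set w : ℕ → ℝ := fun n => √(Real.log (J n) / T n) with hw
  have hwt : Tendsto w atTop (𝓝 0) := by
    have := (Real.continuous_sqrt.tendsto 0).comp hr
    rwa [Real.sqrt_zero] at this
  have hsw : Tendsto (fun n => √(w n)) atTop (𝓝 0) := by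
    have := (Real.continuous_sqrt.tendsto 0).comp hwt
    rwa [Real.sqrt_zero] at this
  have hev : ∀ {f : ℕ → ℝ}, Tendsto f atTop (𝓝 0) → ∀ x : ℝ, ∀ᶠ n in atTop, x * f n ≤ 1 :=
    fun hf x => by
      have := hf.const_mul x
      rw [mul_zero] at this
      exact this.eventually_le_const one_pos
  -- Each smallness condition on `w` is imposed for the scale `1` and for the scale `lam`, because
  -- `J n` may fall on either side of `J₀` as `n` varies.
  filter_upwards [hkT, hρ.eventually_le_const (half_pos hε), hev hwt (2 * (1 : ℕ)),
    hev hwt (2 * lam), hev hsw ((1 : ℕ) * √(A / 2)), hev hsw (lam * √(A / 2)),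
    hev hsw (σ ^ 2 * √(A / 2))] with n hkn hρn hw1 hw1' hw2 hw2' hw3
  intro Ω _ P _ X S hS h
  have hJn : 0 < J n := by have := hJ n; omega
  have hTn : 0 < T n := hT n
  have hlog : 0 < Real.log (J n) := Real.log_pos (by exact_mod_cast hJ n)
  have hTn' : (0 : ℝ) < T n := by exact_mod_cast hTn
  have hrn : 0 < Real.log (J n) / T n := by positivity
  have hwn : 0 < w n := Real.sqrt_pos.2 hrn
  have hpow : ∀ x : ℝ, (Real.log (J n) / T n) ^ (x / 2) = w n ^ x := fun x => by
    rw [show w n = √(Real.log (J n) / T n) from rfl, Real.sqrt_eq_rpow, ← Real.rpow_mul hrn.le]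
    congr 1; ring
  have hpow2 : (Real.log (J n) / T n) ^ (1 - q / 2) = w n ^ (1 - q) * w n := by
    rw [show 1 - q / 2 = (1 - q + 1) / 2 by ring, hpow, Real.rpow_add hwn, Real.rpow_one]
  have hc : 0 ≤ c₀ (J n) := nonneg_of_mem_uniformityClass hJn hS
  have hdiag : ∀ i, S i i ≤ M₁ := fun i => (hS.2.1 i).trans hMM₁
  have hb : C * ((J n : ℝ) ^ (2 + δ') * √(Real.log (J n) * T n))⁻¹ ≤
      C' * ((J n : ℝ) ^ (2 + δ') * √(Real.log (J n) * T n))⁻¹ :=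
    mul_le_mul_of_nonneg_right (le_max_left _ _) (by positivity)
  have hJ1 : 1 ≤ (J n : ℝ) ^ min δ' 1 :=
    Real.one_le_rpow (by exact_mod_cast hJn) hδ1.le
  suffices hmain : ∃ B : Set Ω, P B ≤ ENNReal.ofReal ε ∧ ∀ ω ∉ B,
      opNorm (threshold (M' * w n) (sampleCov fun t i => X t i ω) - S) ≤
        K * (c₀ (J n) * w n ^ (1 - q)) ∧
      (J n : ℝ)⁻¹ * frobSq (threshold (M' * w n) (sampleCov fun t i => X t i ω) - S) ≤
        K * (c₀ (J n) * (w n ^ (1 - q) * w n)) by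
    obtain ⟨B, hB, hBω⟩ := hmain
    rw [hpow, hpow2]
    constructor
    · refine (measure_mono fun ω hω => ?_).trans hB
      by_contra hcon
      exact absurd (hBω ω hcon).1 (not_le.2 hω)
    · refine (measure_mono fun ω hω => ?_).trans hB
      by_contra hcon
      exact absurd (hBω ω hcon).2 (not_le.2 hω)
  have hR1 : 0 ≤ c₀ (J n) * w n ^ (1 - q) := by positivity
  have hR2 : 0 ≤ c₀ (J n) * (w n ^ (1 - q) * w n) := by positivity
  rcases le_total J₀ (J n) with hcase | hcase
  · obtain ⟨B, hB, hBd⟩ := h.exists_deviation_set hρn (half_pos hε).le (half_pos hε).le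
      ((h.measureReal_deviation_le hMM₁ hM₁ hdiag (hJ n) (hT n) rfl hA le_rfl hw1 hw2 hw3 hkn
        hC'0 hb).trans (hJ₀ _ hcase))
    rw [add_halves] at hB
    refine ⟨B, hB, fun ω hω => ?_⟩
    have hdev : ∀ i j, |sampleCov (fun t i => X t i ω) i j - S i j| ≤ M' * w n / 2 := fun i j => by
      have h1 := hBd ω hω i j
      have h2 : 2 * A * w n ≤ M' * w n := by gcongr
      rw [Nat.cast_one, one_pow, one_mul] at h1
      change _ ≤ A * w n at h1
      linarith
    have hs : 0 ≤ M' * w n := by positivity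
    have herr := errors_le_of_abs_threshold_sub_le hJn hq hq1 hM'0 hwn hS
      (fun i j => (abs_threshold_sub_le_of_half hs _ S i j (hdev i j)).1)
      (fun i j => (abs_threshold_sub_le_of_half hs _ S i j (hdev i j)).2)
    exact ⟨herr.1.trans (mul_le_mul_of_nonneg_right (by linarith) hR1),
      herr.2.trans (mul_le_mul_of_nonneg_right (by linarith) hR2)⟩
  · have hlamJ : D / (lam * (J n : ℝ) ^ min δ' 1) ≤ ε / 2 := by
      refine le_trans ?_ hlam
      have : (0 : ℝ) < lam := by exact_mod_cast hlam1
      exact div_le_div_of_nonneg_left hD0.le this (le_mul_of_one_le_right this.le hJ1)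
    obtain ⟨B, hB, hBd⟩ := h.exists_deviation_set hρn (half_pos hε).le (half_pos hε).le
      ((h.measureReal_deviation_le hMM₁ hM₁ hdiag (hJ n) (hT n) rfl hA hlam1 hw1' hw2' hw3 hkn
        hC'0 hb).trans hlamJ)
    rw [add_halves] at hB
    obtain ⟨B', hB', hBω⟩ := h.exists_error_set_of_le hJn hTn hcase hq hq1 hM'0 hwn ha0 haM
      (by positivity : 0 ≤ d) haε hS hB hBd
    exact ⟨B', hB', fun ω hω => ⟨(hBω ω hω).1.trans (mul_le_mul_of_nonneg_right (by linarith) hR1),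
      (hBω ω hω).2.trans (mul_le_mul_of_nonneg_right (by linarith) hR2)⟩⟩

end
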